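/- For $r\ge 1$, a function $t\mapsto \mathfrak a_t\in\mathbb C$ and a set $Z\subseteq(0,\infty)$ let $$V_r(\mathfrak a_t:t\in Z)=\sup\Big(\sum_{j=0}^{J-1}|\mathfrak a_{t_{j+1}}-\mathfrak a_{t_j}|^r\Big)^{1/r},$$ the supremum being over all $J\ge 0$ and all $t_0<t_1<\dots<t_J$ in $Z$ (and $V_r=0$ if $Z=\emptyset$). Let $(X,\mathcal B,\mu)$ be a $\sigma$-finite measure space, $Z\subseteq(0,\infty)$, $Z_n=[2^n,2^{n+1})\cap Z$ for $n\in\mathbb Z$, and let $(T_t:t\in Z)$ be positive linear operators ($T_tf\ge 0$ whenever $f\ge 0$), defined on $\bigcup_{1\le p\le\infty}L^p(X,\mu)$ (complex-valued functions) with values in measurable functions. Let $p_0\in[1,2)$. If $Z$ is uncountable, assume that for every $f\in\bigcup_{p_0<p\le 2}L^p(X,\mu)$ the function $t\mapsto T_tf(x)$ is continuous on $Z$ for almost every $x$. Suppose that the following conditions hold. 1. There are linear operators $(S_n:n\in\mathbb Z)$ on $\bigcup_{1<p\le 2}L^p(X,\mu)$ such that $f=\lim_{N\to\infty}\sum_{|n|\le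 N}S_nf$ in $L^2$ for every $f\in L^2(X,\mu)$ and, for every $p\in(1,2]$ and $f\in L^p(X,\mu)$, $$\Big\|\Big(\sum_{n\in\mathbb Z}|S_nf|^2\Big)^{1/2}\Big\|_{L^p}\le C_{1,p}\|f\|_{L^p}.$$ 2. For every $p\in(p_0,2]$ and $f\in L^p(X,\mu)$, $\ \big\|\sup_{t\in Z}|T_tf|\big\|_{L^p}\le C_{2,p}\|f\|_{L^p}$. 3. For every $p\in(p_0,2]$ and $f\in L^p(X,\mu)$, $\ \sup_{n\in\mathbb Z}\big\|V_p(T_tf:t\in Z_n)\big\|_{L^p}\le C_{3,p}\|f\|_{L^p}$. 4. There are $C_4>0$ and positive numbers $(a_j:j\in\mathbb Z)$ with $\sum_{j\in\mathbb Z}a_j^\rho<\infty$ for every $\rho>0$ such that for every $j\in\mathbb Z$ and $f\in L^2(X,\mu)$, $$\Big\|\Big(\sum_{n\in\mathbb Z}V_2(T_tS_{j+n}f:t\in Z_n)^2\Big)^{1/2}\Big\|_{L^2}\le C_4a_j\|f\|_{L^2}.$$ Then for every $p\in(p_0,2]$ there is $C_p>0$ such that for every $f\in L^p(X,\mu)$,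 $$\Big\|\Big(\sum_{n\in\mathbb Z}V_2(T_tf:t\in Z_n)^2\Big)^{1/2}\Big\|_{L^p}\le C_p\|f\|_{L^p}.$$ Moreover $C_p$ can be chosen to depend only on $p$, $p_0$, the constants $(C_{1,q})_q,(C_{2,q})_q,(C_{3,q})_q$, $C_4$ and the sequence $(a_j)$, and not on $X,\mu,Z,(T_t),(S_n)$. -/

import Mathlib

open MeasureTheory Filter Topology Set
open scoped ENNReal NNReal ComplexOrder

/-- The `r`-variation seminorm `V_r(a_t : t ∈ Z)`: the supremum of
`(∑_{j < J} |a_{t_{j+1}} - a_{t_j}|^r)^{1/r}` over all finite strictly increasing sequences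
`t_0 < t_1 < ... < t_J` of elements of `Z`. -/
noncomputable def rVariation (r : ℝ) (a : ℝ → ℂ) (Z : Set ℝ) : ℝ≥0∞ :=
  ⨆ (J : ℕ) (t : ℕ → ℝ) (_ : ∀ j < J, t j < t (j + 1)) (_ : ∀ j ≤ J, t j ∈ Z),
    (∑ j ∈ Finset.range J, ‖a (t (j + 1)) - a (t j)‖ₑ ^ r) ^ (1 / r)

/-- The dyadic block `Z_n = [2^n, 2^{n+1}) ∩ Z`. -/
def dyadicBlock (Z : Set ℝ) (n : ℤ) : Set ℝ :=
  Set.Ico ((2 : ℝ) ^ n) ((2 : ℝ) ^ (n + 1)) ∩ Z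

/-- The `ℓ²` norm `(∑_{n ∈ ℤ} u_n²)^{1/2}` of a family of extended nonnegative reals. -/
noncomputable def ellTwo (u : ℤ → ℝ≥0∞) : ℝ≥0∞ :=
  (∑' n : ℤ, u n ^ 2) ^ (1 / 2 : ℝ)

/-- `T` is a linear operator defined on `⋃_{p ∈ E} L^p(μ)` with values in the measurable functions.
Functions are identified when they agree almost everywhere; the map `T` picks a representative
`T f : X → ℂ` of the image of `f`. Its values outside `⋃_{p ∈ E} L^p(μ)` are irrelevant. -/
structure IsLinearOnLp {X : Type*} [MeasurableSpace X] (μ : Measure X) (E : Set ℝ≥0∞)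
    (T : (X → ℂ) → (X → ℂ)) : Prop where
  aestronglyMeasurable : ∀ p ∈ E, ∀ f : X → ℂ, MemLp f p μ → AEStronglyMeasurable (T f) μ
  congr_ae : ∀ p ∈ E, ∀ f g : X → ℂ, MemLp f p μ → f =ᵐ[μ] g → T f =ᵐ[μ] T g
  map_add : ∀ p ∈ E, ∀ f g : X → ℂ, MemLp f p μ → MemLp g p μ → T (f + g) =ᵐ[μ] T f + T g
  map_smul : ∀ p ∈ E, ∀ (c : ℂ) (f : X → ℂ), MemLp f p μ → T (c • f) =ᵐ[μ] c • T f

/-- `T` is a positive linear operator on `⋃_{1 ≤ p ≤ ∞} L^p(μ)`: it is linear and maps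
nonnegative functions to nonnegative functions. (For complex `z`, `0 ≤ z` means that `z` is real
and nonnegative.) -/
structure IsPositiveLinearOperator {X : Type*} [MeasurableSpace X] (μ : Measure X)
    (T : (X → ℂ) → (X → ℂ)) : Prop where
  linear : IsLinearOnLp μ (Set.Icc 1 ⊤) T
  nonneg : ∀ p ∈ Set.Icc (1 : ℝ≥0∞) ⊤, ∀ f : X → ℂ, MemLp f p μ →
    (∀ᵐ x ∂μ, 0 ≤ f x) → ∀ᵐ x ∂μ, 0 ≤ T f x

/-!
The variations over the dyadic blocks are controlled by splitting `f = ∑ S m f`, writing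
`m = j + n` on the block with index `n`, and bounding for each shift `j` the square function
`U_j f = (∑_n V_2(T_t S_{j+n} f : t ∈ Z_n)²)^{1/2}`. On `L²` the bound `C₄ a_j` is assumed. If a
bound uniform in `j` is known on `L^s` for some `s ∈ (p₀, p)`, real interpolation
(`lintegral_rpow_le_of_truncation`, with `f` cut at a height inversely proportional to `a_j`) gives
a bound on `L^p` by a sum of two positive powers of `a_j`, which is summable in `j`.

The uniform bound on `L^s` follows from the square function estimate for the `S m` and from the
vector-valued inequality
`‖(∑_n V_2(T_t g_n : t ∈ Z_n)²)^{1/2}‖_s ≤ C ‖(∑_n |g_n|²)^{1/2}‖_s` for arbitrary `g_n`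
(`lintegral_ellTwo_rVariation_le`). It lies between two endpoints on the same space `L^s`: the
`L^s(ℓ^s)` bound with `V_s`, which is the hypothesis on a single block summed over `n`, and the
`L^s(ℓ^∞)` bound with the supremum over `t`, which follows from the maximal inequality because
positivity gives `|T_t g_n| ≤ 2 |T_t (sup_n |g_n|)|`. To interpolate, the variation is linearised by
a measurable choice of the sequence that realises it, and the complex method is applied with `L^s`
fixed and only the inner exponent moving (`lintegral_sum_sq_le_of_interpolation`). Rounding the
relative sizes `|g_n| / (∑ |g_n|²)^{1/2}` and those of the dual function up to a finite grid makes
the analytic function a finite exponential sum, so that neither a density argument nor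
differentiation under the integral sign is needed; the rounding costs a factor `4` only.

All this is carried out for finite `Z`, with constants that do not depend on `Z`. Monotone
convergence covers countable `Z`, and continuity in `t` reduces the uncountable case to a countable
subset that is dense in each block.
-/

/-! ### Linear operators on `L^p` -/

theorem IsLinearOnLp.map_zero {X : Type*} [MeasurableSpace X] {μ : Measure X} {E : Set ℝ≥0∞}
    {T : (X → ℂ) → (X → ℂ)} (hT : IsLinearOnLp μ E T) {p : ℝ≥0∞} (hp : p ∈ E) :
    T 0 =ᵐ[μ] 0 := by
  have h := hT.map_smul p hp 0 0 MemLp.zero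
  simpa using h

theorem IsLinearOnLp.map_sub {X : Type*} [MeasurableSpace X] {μ : Measure X} {E : Set ℝ≥0∞}
    {T : (X → ℂ) → (X → ℂ)} (hT : IsLinearOnLp μ E T) {p : ℝ≥0∞} (hp : p ∈ E) {f g : X → ℂ}
    (hf : MemLp f p μ) (hg : MemLp g p μ) : T (f - g) =ᵐ[μ] T f - T g := by
  have h1 := hT.map_add p hp f ((-1 : ℂ) • g) hf (hg.const_smul _)
  have h2 := hT.map_smul p hp (-1) g hg
  have h3 : f - g = f + (-1 : ℂ) • g := by ext x; simp [sub_eq_add_neg]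
  rw [h3]
  filter_upwards [h1, h2] with x h1 h2
  simp only [h1, Pi.add_apply, h2, Pi.smul_apply, Pi.sub_apply, smul_eq_mul]
  ring

theorem IsLinearOnLp.map_sum_smul {X : Type*} [MeasurableSpace X] {μ : Measure X}
    {E : Set ℝ≥0∞} {T : (X → ℂ) → (X → ℂ)} (hT : IsLinearOnLp μ E T) {p : ℝ≥0∞} (hp : p ∈ E)
    {ι : Type*} (s : Finset ι) (c : ι → ℂ) (f : ι → X → ℂ) (hf : ∀ i ∈ s, MemLp (f i) p μ) :
    T (∑ i ∈ s, c i • f i) =ᵐ[μ] ∑ i ∈ s, c i • T (f i) := by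
  classical
  induction s using Finset.induction_on with
  | empty => simpa using hT.map_zero hp
  | insert i s his ih =>
    rw [Finset.sum_insert his, Finset.sum_insert his]
    have hs : ∀ j ∈ s, MemLp (f j) p μ := fun j hj => hf j (Finset.mem_insert_of_mem hj)
    have hi : MemLp (f i) p μ := hf i (Finset.mem_insert_self _ _)
    have h1 := hT.map_add p hp (c i • f i) (∑ j ∈ s, c j • f j) (hi.const_smul _)
      (memLp_finsetSum' s fun j hj => (hs j hj).const_smul _)
    filter_upwards [h1, hT.map_smul p hp (c i) (f i) hi, ih hs] with x h1 h2 h3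
    simp only [h1, Pi.add_apply, h2, h3]

/-! ### Exponential sums in a vertical strip -/

/-- Maximum principle in the strip `0 ≤ Re z ≤ 1` for finite exponential sums with real
frequencies; such sums are bounded on the strip, so the Phragmén–Lindelöf principle applies. -/
theorem norm_exponentialSum_le_of_strip {ι : Type*} (s : Finset ι) (l m : ι → ℝ) (c : ι → ℂ)
    {C : ℝ} (h0 : ∀ z : ℂ, z.re = 0 → ‖∑ i ∈ s, Complex.exp (l i * z + m i) * c i‖ ≤ C)
    (h1 : ∀ z : ℂ, z.re = 1 → ‖∑ i ∈ s, Complex.exp (l i * z + m i) * c i‖ ≤ C)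
    {θ : ℝ} (hθ0 : 0 ≤ θ) (hθ1 : θ ≤ 1) :
    ‖∑ i ∈ s, Complex.exp (l i * θ + m i) * c i‖ ≤ C := by
  refine PhragmenLindelof.vertical_strip (a := 0) (b := 1)
    (f := fun z : ℂ => ∑ i ∈ s, Complex.exp (l i * z + m i) * c i) (z := (θ : ℂ)) ?_ ?_ h0 h1
    (by simpa using hθ0) (by simpa using hθ1)
  · refine Differentiable.diffContOnCl ?_
    fun_prop
  · refine ⟨0, by simp [Real.pi_pos], 0, ?_⟩
    refine Asymptotics.IsBigO.of_bound (∑ i ∈ s, Real.exp (|l i| + m i) * ‖c i‖) ?_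
    refine Filter.mem_inf_of_right ?_
    intro z hz
    simp only [mem_preimage, mem_Ioo] at hz
    simp only [zero_mul, Real.exp_zero, norm_one, mul_one, mem_ofPred_eq]
    refine (norm_sum_le _ _).trans (Finset.sum_le_sum fun i _ => ?_)
    rw [norm_mul, Complex.norm_exp]
    gcongr
    simp only [Complex.add_re, Complex.mul_re, Complex.ofReal_re, Complex.ofReal_im, zero_mul,
      sub_zero]
    have : l i * z.re ≤ |l i| * 1 :=
      mul_le_mul (le_abs_self _) hz.2.le hz.1.le (abs_nonneg _)
    linarith

/-! ### Rounding up to a finite grid -/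

/-- The indicator that `v` lies in the `i`-th layer `((i - 1) / M, i / M]` of the grid of
step `1 / M`; the layer `i = 0` consists of all `v ≤ 0`. -/
noncomputable def gridLayer (M i : ℕ) (v : ℝ) : ℂ := if ⌈v * M⌉₊ = i then 1 else 0

/-- The complex power `(i / M) ^ e` for a positive integer `i`, written as an exponential. -/
noncomputable def gridPow (M : ℕ) (e : ℂ) (i : ℕ) : ℂ :=
  Complex.exp (e * (Real.log (i / M) : ℝ))

/-- The value `v` rounded up to a multiple of `1 / M`, and `0` for negative `v`. -/
noncomputable def gridCeil (M : ℕ) (v : ℝ) : ℝ := ⌈v * M⌉₊ / M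

theorem measurable_gridLayer (M i : ℕ) : Measurable (gridLayer M i) := by
  unfold gridLayer
  refine Measurable.ite ?_ measurable_const measurable_const
  have : Measurable fun v : ℝ => ⌈v * M⌉₊ := Nat.measurable_ceil.comp (measurable_id.mul_const _)
  exact this (measurableSet_singleton i)

theorem norm_gridLayer_le (M i : ℕ) (v : ℝ) : ‖gridLayer M i v‖ ≤ 1 := by
  unfold gridLayer; split_ifs <;> simp

theorem gridCeil_nonneg (M : ℕ) (v : ℝ) : 0 ≤ gridCeil M v := by
  unfold gridCeil; positivity

theorem le_gridCeil {M : ℕ} (hM : 0 < M) (v : ℝ) : v ≤ gridCeil M v := by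
  unfold gridCeil
  rw [le_div_iff₀ (by positivity)]
  exact Nat.le_ceil _

theorem gridCeil_le {M : ℕ} (hM : 0 < M) {v : ℝ} (hv : 0 ≤ v) : gridCeil M v ≤ v + 1 / M := by
  unfold gridCeil
  rw [div_le_iff₀ (by positivity)]
  have h := (Nat.ceil_lt_add_one (a := v * M) (by positivity)).le
  have hM' : (M : ℝ) ≠ 0 := by positivity
  calc (⌈v * M⌉₊ : ℝ) ≤ v * M + 1 := h
    _ = _ := by field_simp

/-- Rounding up the members of the unit ball of `ℓ²(n)` to a grid of step at most `1 / n` keeps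
the `ℓ²` norm at most `2`. -/
theorem sum_gridCeil_sq_le {N : Type*} [Fintype N] {M : ℕ} (hM : 0 < M)
    (hNM : Fintype.card N ≤ M) (v : N → ℝ) (hv : ∀ n, 0 ≤ v n) (hsum : ∑ n, v n ^ 2 ≤ 1) :
    ∑ n, gridCeil M (v n) ^ 2 ≤ 4 := by
  have hM' : (1 : ℝ) ≤ M := by exact_mod_cast hM
  have h1 : ∀ n, gridCeil M (v n) ^ 2 ≤ 2 * v n ^ 2 + 2 / M ^ 2 := fun n => by
    have h := gridCeil_le hM (hv n)
    calc gridCeil M (v n) ^ 2 ≤ (v n + 1 / M) ^ 2 :=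
          pow_le_pow_left₀ (gridCeil_nonneg _ _) h 2
      _ ≤ 2 * v n ^ 2 + 2 * (1 / M) ^ 2 := by nlinarith [sq_nonneg (v n - 1 / M)]
      _ = _ := by rw [div_pow, one_pow]; ring
  have h2 : (Fintype.card N : ℝ) * (2 / (M : ℝ) ^ 2) ≤ 2 := by
    have : (Fintype.card N : ℝ) ≤ M := by exact_mod_cast hNM
    calc (Fintype.card N : ℝ) * (2 / (M : ℝ) ^ 2) ≤ (M : ℝ) * (2 / (M : ℝ) ^ 2) := by gcongr
      _ = 2 / (M : ℝ) := by field_simp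
      _ ≤ 2 := by rw [div_le_iff₀ (by positivity)]; linarith
  calc ∑ n, gridCeil M (v n) ^ 2 ≤ ∑ n, (2 * v n ^ 2 + 2 / M ^ 2) :=
        Finset.sum_le_sum fun n _ => h1 n
    _ = 2 * ∑ n, v n ^ 2 + Fintype.card N * (2 / M ^ 2) := by
        rw [Finset.sum_add_distrib, ← Finset.mul_sum]; simp
    _ ≤ 4 := by linarith

/-- Only one layer contributes to a sum over all layers. -/
theorem sum_gridLayer_mul {M : ℕ} (hM : 0 < M) {v : ℝ} (hv1 : v ≤ 1) (φ : ℕ → ℂ) :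
    ∑ i ∈ Finset.Icc 1 M, φ i * gridLayer M i v = if v ≤ 0 then 0 else φ ⌈v * M⌉₊ := by
  have hM' : (0 : ℝ) < M := by exact_mod_cast hM
  unfold gridLayer
  simp only [mul_ite, mul_one, mul_zero]
  rw [Finset.sum_ite_eq]
  split_ifs with h1 h2 h2
  · rw [Finset.mem_Icc, Nat.one_le_ceil_iff] at h1
    exact absurd h1.1 (not_lt.2 (mul_nonpos_of_nonpos_of_nonneg h2 hM'.le))
  · rfl
  · rfl
  · refine absurd (Finset.mem_Icc.2 ⟨Nat.one_le_ceil_iff.2 (mul_pos (not_le.1 h2) hM'), ?_⟩) h1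
    rw [Nat.ceil_le]
    nlinarith

theorem norm_gridPow {M : ℕ} (hM : 0 < M) {i : ℕ} (hi : 0 < i) (e : ℂ) :
    ‖gridPow M e i‖ = ((i : ℝ) / M) ^ e.re := by
  have hpos : (0 : ℝ) < (i : ℝ) / M := by positivity
  rw [gridPow, Complex.norm_exp, Complex.re_mul_ofReal, Real.rpow_def_of_pos hpos, mul_comm]

theorem gridPow_one {M : ℕ} (hM : 0 < M) {i : ℕ} (hi : 0 < i) :
    gridPow M 1 i = ((i : ℝ) / M : ℝ) := by
  have hpos : (0 : ℝ) < (i : ℝ) / M := by positivity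
  rw [gridPow, one_mul, ← Complex.ofReal_exp, Real.exp_log hpos]

/-- The modulus of a function built from layers: the layer containing `v` is weighted by
the power `e` of its rounded value. -/
theorem norm_sum_gridPow_le {M : ℕ} (hM : 0 < M) {v : ℝ} (hv1 : v ≤ 1)
    (e w : ℂ) :
    ‖∑ i ∈ Finset.Icc 1 M, gridPow M e i * gridLayer M i v * w‖ ≤ gridCeil M v ^ e.re * ‖w‖ := by
  have hM' : (0 : ℝ) < M := by exact_mod_cast hM
  rw [← Finset.sum_mul, sum_gridLayer_mul hM hv1, norm_mul]
  gcongr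
  split_ifs with h
  · rw [norm_zero]; exact Real.rpow_nonneg (gridCeil_nonneg _ _) _
  · rw [norm_gridPow hM (Nat.ceil_pos.2 (mul_pos (not_le.1 h) hM')), gridCeil]

/-! ### Interpolation between `L^s(ℓ^s)` and `L^s(ℓ^∞)` -/

theorem sum_enorm_rpow_le_of_norm_le {N : Type*} [Fintype N] {a : N → ℂ} {c : N → ℝ} {W τ r : ℝ}
    (hc : ∀ n, 0 ≤ c n) (hW : 0 ≤ W) (hr : 0 < r) (hτ : τ * r = 2)
    (ha : ∀ n, ‖a n‖ ≤ c n ^ τ * W) (hsum : ∑ n, c n ^ 2 ≤ 4) :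
    ∑ n, ‖a n‖ₑ ^ r ≤ 4 * ENNReal.ofReal W ^ r := by
  have h1 : ∀ n, ‖a n‖ₑ ^ r ≤ ENNReal.ofReal (c n ^ 2) * ENNReal.ofReal W ^ r := fun n => by
    rw [← ofReal_norm, ENNReal.ofReal_rpow_of_nonneg (norm_nonneg _) hr.le,
      ENNReal.ofReal_rpow_of_nonneg hW hr.le, ← ENNReal.ofReal_mul (sq_nonneg _)]
    refine ENNReal.ofReal_le_ofReal ?_
    calc ‖a n‖ ^ r ≤ (c n ^ τ * W) ^ r := Real.rpow_le_rpow (norm_nonneg _) (ha n) hr.le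
      _ = c n ^ 2 * W ^ r := by
        rw [Real.mul_rpow (Real.rpow_nonneg (hc n) _) hW, ← Real.rpow_mul (hc n), hτ]
        norm_num
  calc ∑ n, ‖a n‖ₑ ^ r ≤ ∑ n, ENNReal.ofReal (c n ^ 2) * ENNReal.ofReal W ^ r :=
        Finset.sum_le_sum fun n _ => h1 n
    _ = ENNReal.ofReal (∑ n, c n ^ 2) * ENNReal.ofReal W ^ r := by
        rw [← Finset.sum_mul, ENNReal.ofReal_sum_of_nonneg fun n _ => sq_nonneg _]
    _ ≤ ENNReal.ofReal 4 * ENNReal.ofReal W ^ r := by gcongr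
    _ = _ := by norm_num

/-- The Euclidean length of a finite family of complex numbers. -/
noncomputable def euclLength {N : Type*} [Fintype N] (w : N → ℂ) : ℝ := √(∑ n, ‖w n‖ ^ 2)

section euclLength

variable {N : Type*} [Fintype N] (w : N → ℂ)

theorem euclLength_nonneg : 0 ≤ euclLength w := Real.sqrt_nonneg _

theorem sq_euclLength : euclLength w ^ 2 = ∑ n, ‖w n‖ ^ 2 :=
  Real.sq_sqrt (Finset.sum_nonneg fun _ _ => sq_nonneg _)

theorem norm_le_euclLength (n : N) : ‖w n‖ ≤ euclLength w :=
  Real.le_sqrt_of_sq_le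
    (Finset.single_le_sum (f := fun n => ‖w n‖ ^ 2) (fun _ _ => sq_nonneg _) (Finset.mem_univ n))

theorem norm_div_euclLength_le_one (n : N) : ‖w n‖ / euclLength w ≤ 1 :=
  div_le_one_of_le₀ (norm_le_euclLength w n) (euclLength_nonneg w)

theorem norm_div_euclLength_mul (n : N) : ‖w n‖ / euclLength w * euclLength w = ‖w n‖ := by
  rcases (euclLength_nonneg w).eq_or_lt with h | h
  · have := norm_le_euclLength w n
    rw [← h] at this ⊢
    simpa using (le_antisymm this (norm_nonneg _)).symm
  · exact div_mul_cancel₀ _ h.ne'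

theorem sum_sq_norm_div_euclLength_le : ∑ n, (‖w n‖ / euclLength w) ^ 2 ≤ 1 := by
  simp only [div_pow]
  rw [← Finset.sum_div, ← sq_euclLength]
  exact div_self_le_one _

theorem enorm_euclLength_rpow (s : ℝ) :
    ‖euclLength w‖ₑ ^ s = (∑ n, ‖w n‖ₑ ^ 2) ^ (s / 2) := by
  have h1 : ∑ n, ‖w n‖ₑ ^ 2 = ‖euclLength w‖ₑ ^ (2 : ℝ) := by
    rw [ENNReal.rpow_two, ← ofReal_norm, ← ENNReal.ofReal_pow (norm_nonneg _),
      Real.norm_of_nonneg (euclLength_nonneg w), sq_euclLength,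
      ENNReal.ofReal_sum_of_nonneg fun n _ => sq_nonneg _]
    refine Finset.sum_congr rfl fun n _ => ?_
    rw [ENNReal.ofReal_pow (norm_nonneg _), ofReal_norm]
  rw [h1, ← ENNReal.rpow_mul]
  congr 1; ring

/-- The analytic deformation of a vector `w` multiplies the coordinate `w n` by the power `e` of the
rounded value of `‖w n‖ / ‖w‖`. As rounding is upwards, the factor `‖w n‖` in turn contributes at
most one further power. -/
theorem norm_gridDeform_le {M : ℕ} (hM : 0 < M) (e : ℂ) (n : N) :
    ‖∑ i ∈ Finset.Icc 1 M, gridPow M e i * gridLayer M i (‖w n‖ / euclLength w) * w n‖ ≤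
      gridCeil M (‖w n‖ / euclLength w) ^ (e.re + 1) * euclLength w := by
  refine (norm_sum_gridPow_le hM (norm_div_euclLength_le_one w n) e (w n)).trans ?_
  have hv : 0 ≤ ‖w n‖ / euclLength w := div_nonneg (norm_nonneg _) (euclLength_nonneg w)
  have hle := le_gridCeil hM (‖w n‖ / euclLength w)
  have hmul := norm_div_euclLength_mul w n
  rcases (gridCeil_nonneg M (‖w n‖ / euclLength w)).eq_or_lt with h | h
  · rw [← h] at hle
    have h0 : ‖w n‖ = 0 := by rw [← hmul, le_antisymm hle hv, zero_mul]
    rw [h0, mul_zero]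
    exact mul_nonneg (Real.rpow_nonneg (gridCeil_nonneg _ _) _) (euclLength_nonneg w)
  · rw [Real.rpow_add h, Real.rpow_one, mul_assoc]
    have h2 : ‖w n‖ ≤ gridCeil M (‖w n‖ / euclLength w) * euclLength w :=
      calc ‖w n‖ = ‖w n‖ / euclLength w * euclLength w := hmul.symm
        _ ≤ _ := mul_le_mul_of_nonneg_right hle (euclLength_nonneg w)
    exact mul_le_mul_of_nonneg_left h2 (Real.rpow_nonneg h.le _)

end euclLength

theorem AEMeasurable.euclLength {X : Type*} [MeasurableSpace X] {μ : Measure X} {N : Type*}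
    [Fintype N] {w : N → X → ℂ} (hw : ∀ n, AEMeasurable (w n) μ) :
    AEMeasurable (fun x => _root_.euclLength fun n => w n x) μ := by
  unfold _root_.euclLength
  exact (Finset.aemeasurable_fun_sum _ fun n _ => (hw n).norm.pow_const 2).sqrt

theorem MeasureTheory.MemLp.euclLength {X : Type*} [MeasurableSpace X] {μ : Measure X} {N : Type*}
    [Fintype N] {w : N → X → ℂ} {p : ℝ≥0∞} (hw : ∀ n, MemLp (w n) p μ) :
    MemLp (fun x => _root_.euclLength fun n => w n x) p μ := by
  refine MemLp.mono' (g := fun x => ∑ n, ‖w n x‖)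
    (memLp_finsetSum _ fun n _ => (hw n).norm) ?_ ?_
  · exact (AEMeasurable.euclLength fun n => (hw n).1.aemeasurable).aestronglyMeasurable
  · refine ae_of_all _ fun x => ?_
    rw [Real.norm_of_nonneg (euclLength_nonneg _)]
    refine Real.sqrt_le_iff.2 ⟨Finset.sum_nonneg fun _ _ => norm_nonneg _, ?_⟩
    exact Finset.sum_sq_le_sq_sum_of_nonneg fun _ _ => norm_nonneg _

/-- Complex interpolation for a finite family of linear operators: bounds from `L^s(ℓ^s)` to
`L^s(ℓ^s)` and from `L^s(ℓ^∞)` to `L^s(ℓ^∞)` imply a bound from `L^s(ℓ²)` to `L^s(ℓ²)`. Operators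
act diagonally: the output with index `k` depends on the input with index `ν k` only. The second
endpoint is stated with a common majorant `G` of the inputs. -/
theorem lintegral_sum_sq_le_of_interpolation {X : Type*} [MeasurableSpace X] {μ : Measure X}
    {N K : Type*} [Fintype N] [Fintype K] (ν : K → N) (L : K → (X → ℂ) → (X → ℂ)) {s : ℝ}
    (hs1 : 1 < s) (hs2 : s ≤ 2) (hL : ∀ k, IsLinearOnLp μ {ENNReal.ofReal s} (L k)) (A : ℝ≥0)
    (hA : ∀ g : N → X → ℂ, (∀ n, MemLp (g n) (ENNReal.ofReal s) μ) →
      ∫⁻ x, ∑ k, ‖L k (g (ν k)) x‖ₑ ^ s ∂μ ≤ (A : ℝ≥0∞) ^ s * ∫⁻ x, ∑ n, ‖g n x‖ₑ ^ s ∂μ)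
    (hB : ∀ (g : N → X → ℂ) (G : X → ℝ), (∀ n, MemLp (g n) (ENNReal.ofReal s) μ) →
      MemLp G (ENNReal.ofReal s) μ → (∀ n x, ‖g n x‖ ≤ G x) →
      ∫⁻ x, (⨆ k, ‖L k (g (ν k)) x‖ₑ) ^ s ∂μ ≤ (A : ℝ≥0∞) ^ s * ∫⁻ x, ‖G x‖ₑ ^ s ∂μ)
    (g : N → X → ℂ) (hg : ∀ n, MemLp (g n) (ENNReal.ofReal s) μ) :
    ∫⁻ x, (∑ k, ‖L k (g (ν k)) x‖ₑ ^ 2) ^ (s / 2) ∂μ ≤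
      (4 * A : ℝ≥0∞) ^ s * ∫⁻ x, (∑ n, ‖g n x‖ₑ ^ 2) ^ (s / 2) ∂μ := by
  classical
  have hs0 : 0 < s := by linarith
  have hp0 : ENNReal.ofReal s ≠ 0 := by simpa using hs0
  have hptop : ENNReal.ofReal s ≠ ∞ := ENNReal.ofReal_ne_top
  have hptoReal : (ENNReal.ofReal s).toReal = s := ENNReal.toReal_ofReal hs0.le
  have hpq : s.HolderConjugate (s / (s - 1)) := Real.HolderConjugate.conjExponent hs1
  set s' : ℝ := s / (s - 1) with hs'
  have hs'0 : 0 < s' := hpq.symm.pos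
  -- the number of grid points exceeds the number of coordinates on both sides of the pairing
  set M : ℕ := Fintype.card N + Fintype.card K + 1 with hMdef
  have hM : 0 < M := by omega
  -- the operators map `L^s` to `L^s`
  have hLmem : ∀ (k : K) (f : X → ℂ), MemLp f (ENNReal.ofReal s) μ →
      MemLp (L k f) (ENNReal.ofReal s) μ := fun k f hf => by
    refine ⟨(hL k).aestronglyMeasurable _ rfl f hf, ?_⟩
    rw [eLpNorm_lt_top_iff_lintegral_rpow_enorm_lt_top hp0 hptop, hptoReal]
    have h := hA (fun _ => f) fun _ => hf
    refine (lintegral_mono fun x => ?_).trans_lt (h.trans_lt ?_)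
    · exact Finset.single_le_sum (f := fun k => ‖L k f x‖ₑ ^ s) (fun _ _ => zero_le)
        (Finset.mem_univ k)
    · have hfin := (eLpNorm_lt_top_iff_lintegral_rpow_enorm_lt_top hp0 hptop).1 hf.2
      rw [hptoReal] at hfin
      simp only [Finset.sum_const, nsmul_eq_mul]
      rw [lintegral_const_mul' _ _ (by simp)]
      exact ENNReal.mul_lt_top (ENNReal.rpow_lt_top_of_nonneg hs0.le ENNReal.coe_ne_top)
        (ENNReal.mul_lt_top (by simp) hfin)
  set D : X → ℝ := fun x => euclLength fun k => L k (g (ν k)) x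
  set G : X → ℝ := fun x => euclLength fun n => g n x
  have hDk : ∀ k, MemLp (L k (g (ν k))) (ENNReal.ofReal s) μ := fun k => hLmem k _ (hg _)
  have hD : MemLp D (ENNReal.ofReal s) μ := MemLp.euclLength hDk
  have hG : MemLp G (ENNReal.ofReal s) μ := MemLp.euclLength hg
  have hD0 : ∀ x, 0 ≤ D x := fun x => euclLength_nonneg _
  have hG0 : ∀ x, 0 ≤ G x := fun x => euclLength_nonneg _
  have hfin : ∀ {F : X → ℝ}, MemLp F (ENNReal.ofReal s) μ → ∫⁻ x, ‖F x‖ₑ ^ s ∂μ < ∞ := by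
    intro F hF
    have h := (eLpNorm_lt_top_iff_lintegral_rpow_enorm_lt_top hp0 hptop).1 hF.2
    rwa [hptoReal] at h
  have hY := hfin hD
  have hX := hfin hG
  simp_rw [← enorm_euclLength_rpow]
  change ∫⁻ x, ‖D x‖ₑ ^ s ∂μ ≤ (4 * A : ℝ≥0∞) ^ s * ∫⁻ x, ‖G x‖ₑ ^ s ∂μ
  -- the layers of `g` and of the dual function
  set gi : N → ℕ → X → ℂ := fun n i x => gridLayer M i (‖g n x‖ / G x) * g n x with hgidef
  have hgi : ∀ n i, MemLp (gi n i) (ENNReal.ofReal s) μ := fun n i => by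
    refine MemLp.of_le (hg n) ?_ (ae_of_all _ fun x => ?_)
    · refine AEMeasurable.aestronglyMeasurable ?_
      exact ((measurable_gridLayer M i).comp_aemeasurable
        ((hg n).1.aemeasurable.norm.div hG.1.aemeasurable)).mul (hg n).1.aemeasurable
    · rw [norm_mul]
      exact mul_le_of_le_one_left (norm_nonneg _) (norm_gridLayer_le _ _ _)
  set σ : K → X → ℂ := fun k x => (starRingEnd ℂ) (L k (g (ν k)) x) / ‖L k (g (ν k)) x‖ *
    ((D x ^ (s - 1) : ℝ) : ℂ) with hσdef
  have hσnorm : ∀ k x, ‖σ k x‖ ≤ D x ^ (s - 1) := fun k x => by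
    simp only [hσdef, norm_mul, norm_div, RCLike.norm_conj, Complex.norm_real, norm_norm]
    rw [Real.norm_of_nonneg (Real.rpow_nonneg (hD0 x) _)]
    exact mul_le_of_le_one_left (Real.rpow_nonneg (hD0 x) _) (div_self_le_one _)
  have hσmeas : ∀ k, AEMeasurable (σ k) μ := fun k => by
    have h1 := (hDk k).1.aemeasurable
    have h2 : AEMeasurable (fun x => (starRingEnd ℂ) (L k (g (ν k)) x)) μ :=
      Complex.continuous_conj.measurable.comp_aemeasurable h1
    exact (h2.div (Complex.measurable_ofReal.comp_aemeasurable h1.norm)).mul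
      (Complex.measurable_ofReal.comp_aemeasurable (hD.1.aemeasurable.pow_const _))
  set ψ : K → ℕ → X → ℂ := fun k l x => gridLayer M l (‖L k (g (ν k)) x‖ / D x) * σ k x with hψdef
  have hDs' : ∀ x, ENNReal.ofReal (D x ^ (s - 1)) ^ s' = ‖D x‖ₑ ^ s := fun x => by
    rw [← ENNReal.ofReal_rpow_of_nonneg (hD0 x) (by linarith), ← ENNReal.rpow_mul,
      ← ofReal_norm, Real.norm_of_nonneg (hD0 x)]
    congr 1
    rw [hs']; field_simp [(sub_pos.2 hs1).ne']
  have hψmeas : ∀ k l, AEMeasurable (ψ k l) μ := fun k l =>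
    ((measurable_gridLayer M l).comp_aemeasurable
        ((hDk k).1.aemeasurable.norm.div hD.1.aemeasurable)).mul (hσmeas k)
  have hψ : ∀ k l, MemLp (ψ k l) (ENNReal.ofReal s') μ := fun k l => by
    refine ⟨(hψmeas k l).aestronglyMeasurable, ?_⟩
    rw [eLpNorm_lt_top_iff_lintegral_rpow_enorm_lt_top (by simpa using hs'0)
      ENNReal.ofReal_ne_top, ENNReal.toReal_ofReal hs'0.le]
    refine (lintegral_mono fun x => ?_).trans_lt hY
    rw [← hDs', ← ofReal_norm]
    gcongr
    rw [norm_mul]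
    exact (mul_le_of_le_one_left (norm_nonneg _) (norm_gridLayer_le _ _ _)).trans (hσnorm k x)
  -- with `ṽ` and `ũ` the rounded values, `gz z` is `g ṽ ^ (2 z / s - 1)` and `hz z` is the dual
  -- function `σ ũ ^ (2 - 2 z / s)`; for `z = s / 2` these are `g` and `σ ũ`
  set gz : ℂ → N → X → ℂ := fun z n =>
    ∑ i ∈ Finset.Icc 1 M, gridPow M (2 / s * z - 1) i • gi n i with hgzdef
  have hgz : ∀ z n, MemLp (gz z n) (ENNReal.ofReal s) μ := fun z n =>
    memLp_finsetSum' _ fun i _ => (hgi n i).const_smul _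
  set hz : ℂ → K → X → ℂ := fun z k x =>
    ∑ l ∈ Finset.Icc 1 M, gridPow M (2 - 2 / s * z) l * ψ k l x with hhzdef
  have hhzmeas : ∀ z k, AEMeasurable (hz z k) μ := fun z k =>
    Finset.aemeasurable_fun_sum _ fun l _ => (hψmeas k l).const_mul _
  have hgz_norm : ∀ z n x, ‖gz z n x‖ ≤
      gridCeil M (‖g n x‖ / G x) ^ (2 / s * z.re) * G x := fun z n x => by
    have h := norm_gridDeform_le (fun n => g n x) hM (2 / s * z - 1) n
    have he : (2 / s * z - 1 : ℂ).re + 1 = 2 / s * z.re := by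
      have : (2 / s * z : ℂ) = ((2 / s : ℝ) : ℂ) * z := by push_cast; ring
      rw [Complex.sub_re, this, Complex.re_ofReal_mul]; simp
    rw [he] at h
    refine le_of_eq_of_le ?_ h
    simp only [hgzdef, hgidef, Finset.sum_apply, Pi.smul_apply, smul_eq_mul, mul_assoc]
    rfl
  have hhz_norm : ∀ z k x, ‖hz z k x‖ ≤
      gridCeil M (‖L k (g (ν k)) x‖ / D x) ^ (2 - 2 / s * z.re) * D x ^ (s - 1) := fun z k x => by
    have h := norm_sum_gridPow_le hM
      (norm_div_euclLength_le_one (fun k => L k (g (ν k)) x) k) (2 - 2 / s * z) (σ k x)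
    have he : (2 - 2 / s * z : ℂ).re = 2 - 2 / s * z.re := by
      have : (2 / s * z : ℂ) = ((2 / s : ℝ) : ℂ) * z := by push_cast; ring
      rw [Complex.sub_re, this, Complex.re_ofReal_mul]; simp
    rw [he] at h
    refine le_trans ?_ (h.trans ?_)
    · simp only [hhzdef, hψdef, mul_assoc]; rfl
    · exact mul_le_mul_of_nonneg_left (hσnorm k x) (Real.rpow_nonneg (gridCeil_nonneg _ _) _)
  -- the pairing of `L (gz z)` with `hz z`, expanded as an exponential sum in `z`
  set idx : Finset (K × ℕ × ℕ) := Finset.univ ×ˢ Finset.Icc 1 M ×ˢ Finset.Icc 1 M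
  set c : K × ℕ × ℕ → ℂ := fun q => ∫ x, L q.1 (gi (ν q.1) q.2.1) x * ψ q.1 q.2.2 x ∂μ
  set lam : K × ℕ × ℕ → ℝ := fun q =>
    2 / s * Real.log (q.2.1 / M) - 2 / s * Real.log (q.2.2 / M) with hlamdef
  set mu : K × ℕ × ℕ → ℝ := fun q => 2 * Real.log (q.2.2 / M) - Real.log (q.2.1 / M) with hmudef
  have hpqe : (ENNReal.ofReal s).HolderConjugate (ENNReal.ofReal s') := hpq.ennrealOfReal
  have hint : ∀ k i l, Integrable (fun x => L k (gi (ν k) i) x * ψ k l x) μ := fun k i l =>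
    (hLmem k _ (hgi _ _)).integrable_mul (hψ k l)
  have hF : ∀ z : ℂ, ∑ q ∈ idx, Complex.exp (lam q * z + mu q) * c q =
      ∫ x, ∑ k, L k (gz z (ν k)) x * hz z k x ∂μ := fun z => by
    have h1 : ∀ᵐ x ∂μ, ∑ k, L k (gz z (ν k)) x * hz z k x =
        ∑ q ∈ idx, Complex.exp (lam q * z + mu q) *
          (L q.1 (gi (ν q.1) q.2.1) x * ψ q.1 q.2.2 x) := by
      have h2 : ∀ k, L k (gz z (ν k)) =ᵐ[μ] ∑ i ∈ Finset.Icc 1 M,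
          gridPow M (2 / s * z - 1) i • L k (gi (ν k) i) := fun k =>
        (hL k).map_sum_smul rfl _ _ _ fun i _ => hgi _ _
      filter_upwards [ae_all_iff.2 h2] with x hx
      rw [Finset.sum_product]
      refine Finset.sum_congr rfl fun k _ => ?_
      rw [hx k, Finset.sum_product, Finset.sum_apply, Finset.sum_mul_sum]
      refine Finset.sum_congr rfl fun i _ => Finset.sum_congr rfl fun l _ => ?_
      have : Complex.exp (lam (k, i, l) * z + mu (k, i, l)) =
          gridPow M (2 / s * z - 1) i * gridPow M (2 - 2 / s * z) l := by
        rw [gridPow, gridPow, ← Complex.exp_add]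
        congr 1
        simp only [hlamdef, hmudef]
        push_cast; ring
      rw [this, Pi.smul_apply, smul_eq_mul]
      ring
    rw [integral_congr_ae h1, integral_finsetSum _ fun q _ => (hint _ _ _).const_mul _]
    exact Finset.sum_congr rfl fun q _ => (integral_const_mul _ _).symm
  have hFint : ∀ z : ℂ, Integrable (fun x => ∑ k, L k (gz z (ν k)) x * hz z k x) μ := fun z =>
    integrable_finsetSum _ fun k _ => (hLmem k _ (hgz z _)).integrable_mul
      (memLp_finsetSum _ fun l _ => (hψ k l).const_mul _)
  have hbound : ∀ z : ℂ, ‖∑ q ∈ idx, Complex.exp (lam q * z + mu q) * c q‖ₑ ≤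
      ∫⁻ x, ∑ k, ‖L k (gz z (ν k)) x‖ₑ * ‖hz z k x‖ₑ ∂μ := fun z => by
    rw [hF z]
    refine (enorm_integral_le_lintegral_enorm _).trans (lintegral_mono fun x => ?_)
    refine (enorm_sum_le _ _).trans (Finset.sum_le_sum fun k _ => ?_)
    rw [enorm_mul]
  set X₀ : ℝ≥0∞ := ∫⁻ x, ‖G x‖ₑ ^ s ∂μ with hX₀
  set Y : ℝ≥0∞ := ∫⁻ x, ‖D x‖ₑ ^ s ∂μ with hYdef
  set B : ℝ≥0∞ := (A * X₀ ^ (1 / s)) * (4 * Y ^ (1 / s')) with hBdef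
  have hBtop : B ≠ ∞ := by
    refine ENNReal.mul_ne_top (ENNReal.mul_ne_top ENNReal.coe_ne_top ?_)
      (ENNReal.mul_ne_top (by norm_num) ?_)
    · exact (ENNReal.rpow_lt_top_of_nonneg (by positivity) hX.ne).ne
    · exact (ENNReal.rpow_lt_top_of_nonneg (by positivity) hY.ne).ne
  have hLmeas : ∀ z k, AEMeasurable (fun x => ‖L k (gz z (ν k)) x‖ₑ) μ := fun z k =>
    (hLmem k _ (hgz z _)).1.aemeasurable.enorm
  have hsumG : ∀ x, ∑ n, gridCeil M (‖g n x‖ / G x) ^ 2 ≤ 4 := fun x =>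
    sum_gridCeil_sq_le hM (by omega) _ (fun n => div_nonneg (norm_nonneg _) (hG0 x))
      (sum_sq_norm_div_euclLength_le fun n => g n x)
  have hsumD : ∀ x, ∑ k, gridCeil M (‖L k (g (ν k)) x‖ / D x) ^ 2 ≤ 4 := fun x =>
    sum_gridCeil_sq_le hM (by omega) _ (fun n => div_nonneg (norm_nonneg _) (hD0 x))
      (sum_sq_norm_div_euclLength_le fun k => L k (g (ν k)) x)
  have hDrpow0 : ∀ x, 0 ≤ D x ^ (s - 1) := fun x => Real.rpow_nonneg (hD0 x) _
  have hofG : ∀ x, ENNReal.ofReal (G x) ^ s = ‖G x‖ₑ ^ s := fun x => by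
    rw [← ofReal_norm, Real.norm_of_nonneg (hG0 x)]
  have hofD : ∀ x, ENNReal.ofReal (D x) ^ s = ‖D x‖ₑ ^ s := fun x => by
    rw [← ofReal_norm, Real.norm_of_nonneg (hD0 x)]
  -- the boundary line of the endpoint `ℓ^∞`
  have hline0 : ∀ z : ℂ, z.re = 0 →
      ‖∑ q ∈ idx, Complex.exp (lam q * z + mu q) * c q‖ ≤ B.toReal := fun z hz0 => by
    rw [← toReal_enorm]
    refine ENNReal.toReal_mono hBtop ((hbound z).trans ?_)
    calc ∫⁻ x, ∑ k, ‖L k (gz z (ν k)) x‖ₑ * ‖hz z k x‖ₑ ∂μ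
        ≤ ∫⁻ x, ((fun x => ⨆ k, ‖L k (gz z (ν k)) x‖ₑ) * fun x => ∑ k, ‖hz z k x‖ₑ) x ∂μ := by
          refine lintegral_mono fun x => ?_
          rw [Pi.mul_apply, Finset.mul_sum]
          refine Finset.sum_le_sum fun k _ => ?_
          gcongr
          exact le_iSup (fun k => ‖L k (gz z (ν k)) x‖ₑ) k
      _ ≤ (∫⁻ x, (⨆ k, ‖L k (gz z (ν k)) x‖ₑ) ^ s ∂μ) ^ (1 / s) *
          (∫⁻ x, (∑ k, ‖hz z k x‖ₑ) ^ s' ∂μ) ^ (1 / s') :=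
          ENNReal.lintegral_mul_le_Lp_mul_Lq μ hpq (AEMeasurable.iSup fun k => hLmeas z k)
            (Finset.aemeasurable_fun_sum _ fun k _ => (hhzmeas z k).enorm)
      _ ≤ ((A : ℝ≥0∞) ^ s * X₀) ^ (1 / s) * (4 ^ s' * Y) ^ (1 / s') := by
          gcongr
          · refine hB (gz z) G (hgz z) hG fun n x => ?_
            simpa [hz0] using hgz_norm z n x
          · rw [hYdef, ← lintegral_const_mul' _ _
              (ENNReal.rpow_lt_top_of_nonneg hs'0.le (by norm_num)).ne]
            refine lintegral_mono fun x => ?_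
            rw [← hDs', ← ENNReal.mul_rpow_of_nonneg _ _ hs'0.le]
            gcongr
            have h := sum_enorm_rpow_le_of_norm_le (a := fun k => hz z k x) (τ := 2) (r := 1)
              (fun k => gridCeil_nonneg M (‖L k (g (ν k)) x‖ / D x)) (hDrpow0 x) one_pos
              (by norm_num) (fun k => by simpa [hz0] using hhz_norm z k x) (hsumD x)
            simpa using h
      _ = B := by
          rw [hBdef, ENNReal.mul_rpow_of_nonneg _ _ (by positivity),
            ENNReal.mul_rpow_of_nonneg _ _ (by positivity), ← ENNReal.rpow_mul,
            ← ENNReal.rpow_mul, mul_one_div_cancel hs0.ne', mul_one_div_cancel hs'0.ne',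
            ENNReal.rpow_one, ENNReal.rpow_one]
  -- the boundary line of the endpoint `ℓ^s`
  have hline1 : ∀ z : ℂ, z.re = 1 →
      ‖∑ q ∈ idx, Complex.exp (lam q * z + mu q) * c q‖ ≤ B.toReal := fun z hz1 => by
    rw [← toReal_enorm]
    refine ENNReal.toReal_mono hBtop ((hbound z).trans ?_)
    calc ∫⁻ x, ∑ k, ‖L k (gz z (ν k)) x‖ₑ * ‖hz z k x‖ₑ ∂μ
        ≤ ∫⁻ x, ((fun x => (∑ k, ‖L k (gz z (ν k)) x‖ₑ ^ s) ^ (1 / s)) *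
            fun x => (∑ k, ‖hz z k x‖ₑ ^ s') ^ (1 / s')) x ∂μ :=
          lintegral_mono fun x => ENNReal.inner_le_Lp_mul_Lq _ _ _ hpq
      _ ≤ (∫⁻ x, ((∑ k, ‖L k (gz z (ν k)) x‖ₑ ^ s) ^ (1 / s)) ^ s ∂μ) ^ (1 / s) *
          (∫⁻ x, ((∑ k, ‖hz z k x‖ₑ ^ s') ^ (1 / s')) ^ s' ∂μ) ^ (1 / s') :=
          ENNReal.lintegral_mul_le_Lp_mul_Lq μ hpq
            ((Finset.aemeasurable_fun_sum _ fun k _ => (hLmeas z k).pow_const _).pow_const _)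
            ((Finset.aemeasurable_fun_sum _ fun k _ =>
              (hhzmeas z k).enorm.pow_const _).pow_const _)
      _ = (∫⁻ x, ∑ k, ‖L k (gz z (ν k)) x‖ₑ ^ s ∂μ) ^ (1 / s) *
          (∫⁻ x, ∑ k, ‖hz z k x‖ₑ ^ s' ∂μ) ^ (1 / s') := by
          simp_rw [← ENNReal.rpow_mul, one_div_mul_cancel hs0.ne', one_div_mul_cancel hs'0.ne',
            ENNReal.rpow_one]
      _ ≤ ((A : ℝ≥0∞) ^ s * (4 * X₀)) ^ (1 / s) * (4 * Y) ^ (1 / s') := by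
          gcongr
          · refine (hA (gz z) (hgz z)).trans ?_
            gcongr
            rw [hX₀, ← lintegral_const_mul' _ _ (by norm_num)]
            refine lintegral_mono fun x => ?_
            rw [← hofG]
            refine sum_enorm_rpow_le_of_norm_le (τ := 2 / s)
              (fun n => gridCeil_nonneg M (‖g n x‖ / G x)) (hG0 x) hs0
              (div_mul_cancel₀ _ hs0.ne') (fun n => ?_) (hsumG x)
            simpa [hz1] using hgz_norm z n x
          · rw [hYdef, ← lintegral_const_mul' _ _ (by norm_num)]
            refine lintegral_mono fun x => ?_
            rw [← hDs']
            refine sum_enorm_rpow_le_of_norm_le (τ := 2 - 2 / s)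
              (fun k => gridCeil_nonneg M (‖L k (g (ν k)) x‖ / D x)) (hDrpow0 x) hs'0
              ?_ (fun k => ?_) (hsumD x)
            · rw [hs']; field_simp [(sub_pos.2 hs1).ne']
            · simpa [hz1] using hhz_norm z k x
      _ = B := by
          have h4 : (4 : ℝ≥0∞) ^ (1 / s) * 4 ^ (1 / s') = 4 := by
            rw [← ENNReal.rpow_add _ _ (by norm_num) (by norm_num), one_div, one_div,
              hpq.inv_add_inv_eq_one, ENNReal.rpow_one]
          rw [hBdef, ENNReal.mul_rpow_of_nonneg _ _ (by positivity),
            ENNReal.mul_rpow_of_nonneg _ _ (by positivity),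
            ENNReal.mul_rpow_of_nonneg _ _ (by positivity), ← ENNReal.rpow_mul,
            mul_one_div_cancel hs0.ne', ENNReal.rpow_one]
          calc (A : ℝ≥0∞) * (4 ^ (1 / s) * X₀ ^ (1 / s)) * (4 ^ (1 / s') * Y ^ (1 / s'))
              = A * X₀ ^ (1 / s) * ((4 ^ (1 / s) * 4 ^ (1 / s')) * Y ^ (1 / s')) := by ring
            _ = _ := by rw [h4]
  have hmid := norm_exponentialSum_le_of_strip idx lam mu c hline0 hline1
    (θ := s / 2) (by positivity) (by linarith)
  -- at the intermediate point the pairing recovers the left-hand side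
  have hgθ : ∀ n, gz ((s / 2 : ℝ) : ℂ) n = g n := fun n => by
    have he : (2 / s * ((s / 2 : ℝ) : ℂ) - 1 : ℂ) = 0 := by
      have : (s : ℂ) ≠ 0 := by exact_mod_cast hs0.ne'
      push_cast; field_simp; norm_num
    ext x
    have h := sum_gridLayer_mul hM (norm_div_euclLength_le_one (fun n => g n x) n) fun _ => 1
    simp only [hgzdef, hgidef, Finset.sum_apply, Pi.smul_apply, smul_eq_mul, he, gridPow,
      zero_mul, Complex.exp_zero, one_mul, ← Finset.sum_mul]
    simp only [one_mul] at h
    change (∑ i ∈ Finset.Icc 1 M, gridLayer M i (‖g n x‖ / euclLength fun n => g n x)) * g n x = _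
    rw [h]
    split_ifs with h0
    · have h1 := norm_div_euclLength_mul (fun n => g n x) n
      have h2 : ‖g n x‖ ≤ 0 := by
        rw [← h1]; exact mul_nonpos_of_nonpos_of_nonneg h0 (euclLength_nonneg _)
      simp [norm_le_zero_iff.1 h2]
    · exact one_mul _
  have hhθ : ∀ k x, L k (g (ν k)) x * hz ((s / 2 : ℝ) : ℂ) k x =
      ((‖L k (g (ν k)) x‖ * (if ‖L k (g (ν k)) x‖ / D x ≤ 0 then 0 else
        gridCeil M (‖L k (g (ν k)) x‖ / D x)) * D x ^ (s - 1) : ℝ) : ℂ) := fun k x => by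
    have he : (2 - 2 / s * ((s / 2 : ℝ) : ℂ) : ℂ) = 1 := by
      have : (s : ℂ) ≠ 0 := by exact_mod_cast hs0.ne'
      push_cast; field_simp; norm_num
    have h := sum_gridLayer_mul hM (norm_div_euclLength_le_one (fun k => L k (g (ν k)) x) k)
      (gridPow M 1)
    have h1 : L k (g (ν k)) x * ((starRingEnd ℂ) (L k (g (ν k)) x) / ‖L k (g (ν k)) x‖) =
        (‖L k (g (ν k)) x‖ : ℝ) := by
      rw [← mul_div_assoc, Complex.mul_conj', sq, mul_self_div_self]
    have h2 : hz ((s / 2 : ℝ) : ℂ) k x = (if ‖L k (g (ν k)) x‖ / D x ≤ 0 then 0 else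
        gridPow M 1 ⌈‖L k (g (ν k)) x‖ / D x * M⌉₊) * σ k x := by
      refine Eq.trans ?_ (congrArg (· * σ k x) h)
      simp only [hhzdef, he, hψdef, Finset.sum_mul, mul_assoc]
      rfl
    rw [h2]
    simp only [hσdef]
    split_ifs with h0
    · simp
    · rw [gridPow_one hM (Nat.ceil_pos.2 (mul_pos (not_le.1 h0) (by positivity))), gridCeil,
        Complex.ofReal_mul, Complex.ofReal_mul]
      linear_combination ((⌈‖L k (g (ν k)) x‖ / D x * M⌉₊ / M : ℝ) : ℂ) *
        ((D x ^ (s - 1) : ℝ) : ℂ) * h1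
  have hlow : Y ≤ ‖∑ q ∈ idx, Complex.exp (lam q * ((s / 2 : ℝ) : ℂ) + mu q) * c q‖ₑ := by
    rw [hF]
    simp only [hgθ, hhθ]
    have hR := hFint ((s / 2 : ℝ) : ℂ)
    simp only [hgθ, hhθ] at hR
    simp only [← Complex.ofReal_sum] at hR ⊢
    rw [integral_complex_ofReal, ← ofReal_norm, Complex.norm_real]
    refine le_trans ?_ (ENNReal.ofReal_le_ofReal (le_abs_self _))
    have hterm : ∀ k x, 0 ≤ (if ‖L k (g (ν k)) x‖ / D x ≤ 0 then 0 else
        gridCeil M (‖L k (g (ν k)) x‖ / D x)) := fun k x => by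
      split_ifs
      exacts [le_rfl, gridCeil_nonneg _ _]
    have hterm' : ∀ k x, ‖L k (g (ν k)) x‖ / D x ≤ (if ‖L k (g (ν k)) x‖ / D x ≤ 0 then 0 else
        gridCeil M (‖L k (g (ν k)) x‖ / D x)) := fun k x => by
      split_ifs with h
      exacts [h, le_gridCeil hM _]
    rw [ofReal_integral_eq_lintegral_ofReal (by simpa using hR.re)
      (ae_of_all _ fun x => Finset.sum_nonneg fun k _ =>
        mul_nonneg (mul_nonneg (norm_nonneg _) (hterm k x)) (hDrpow0 x))]
    refine lintegral_mono fun x => ?_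
    rw [← hofD, ENNReal.ofReal_rpow_of_nonneg (hD0 x) hs0.le]
    refine ENNReal.ofReal_le_ofReal ?_
    rcases (hD0 x).eq_or_lt with h | h
    · refine le_of_eq_of_le (b := 0) (by rw [← h, Real.zero_rpow hs0.ne']) ?_
      exact Finset.sum_nonneg fun k _ =>
        mul_nonneg (mul_nonneg (norm_nonneg _) (hterm k x)) (hDrpow0 x)
    · calc D x ^ s = (∑ k, ‖L k (g (ν k)) x‖ ^ 2) / D x * D x ^ (s - 1) := by
            rw [← sq_euclLength (fun k => L k (g (ν k)) x)]
            change D x ^ s = D x ^ 2 / D x * D x ^ (s - 1)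
            rw [Real.rpow_sub_one h.ne']
            field_simp
        _ ≤ _ := by
            rw [Finset.sum_div, Finset.sum_mul]
            refine Finset.sum_le_sum fun k _ => ?_
            refine mul_le_mul_of_nonneg_right ?_ (hDrpow0 x)
            rw [sq, mul_div_assoc]
            exact mul_le_mul_of_nonneg_left (hterm' k x) (norm_nonneg _)
  have hYB : Y ≤ B := hlow.trans (by
    rw [← ofReal_norm, ← ENNReal.ofReal_toReal hBtop]
    exact ENNReal.ofReal_le_ofReal hmid)
  rcases eq_or_ne Y 0 with h0 | h0
  · rw [h0]; exact zero_le
  have hYs' : Y ^ (1 / s) ≤ 4 * A * X₀ ^ (1 / s) := by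
    have h1 : Y ^ (1 / s) * Y ^ (1 / s') = Y := by
      rw [← ENNReal.rpow_add _ _ h0 hY.ne, one_div, one_div, hpq.inv_add_inv_eq_one,
        ENNReal.rpow_one]
    have h2 : Y ^ (1 / s') ≠ 0 := by simp [h0, hY.ne]
    have h3 : Y ^ (1 / s') ≠ ∞ := (ENNReal.rpow_lt_top_of_nonneg (by positivity) hY.ne).ne
    refine (ENNReal.mul_le_mul_iff_left h2 h3).1 ?_
    rw [h1]
    refine hYB.trans_eq ?_
    rw [hBdef]; ring
  calc Y = (Y ^ (1 / s)) ^ s := by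
        rw [← ENNReal.rpow_mul, one_div_mul_cancel hs0.ne', ENNReal.rpow_one]
    _ ≤ (4 * A * X₀ ^ (1 / s)) ^ s := by gcongr
    _ = _ := by
        rw [ENNReal.mul_rpow_of_nonneg _ _ hs0.le, ← ENNReal.rpow_mul,
          one_div_mul_cancel hs0.ne', ENNReal.rpow_one]

/-! ### The variation seminorm -/

/-- The finite sets `{(t 0, t 1), (t 1, t 2), …, (t (J - 1), t J)}` of consecutive pairs of strictly
increasing finite sequences in `Z`. The empty set is included, even if `Z` is empty. -/
def chainPairs (Z : Set ℝ) : Set (Finset (ℝ × ℝ)) :=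
  {P | ∃ (J : ℕ) (t : ℕ → ℝ), (∀ j < J, t j < t (j + 1)) ∧ (∀ j < J, t j ∈ Z ∧ t (j + 1) ∈ Z) ∧
    P = (Finset.range J).image fun j => (t j, t (j + 1))}

theorem empty_mem_chainPairs (Z : Set ℝ) : ∅ ∈ chainPairs Z :=
  ⟨0, fun _ => 0, by simp, by simp, by simp⟩

theorem mem_of_mem_chainPairs {Z : Set ℝ} {P : Finset (ℝ × ℝ)} (hP : P ∈ chainPairs Z)
    {q : ℝ × ℝ} (hq : q ∈ P) : q ∈ Z ×ˢ Z := by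
  obtain ⟨J, t, -, h2, rfl⟩ := hP
  obtain ⟨j, hj, rfl⟩ := Finset.mem_image.1 hq
  exact h2 j (Finset.mem_range.1 hj)

theorem finite_chainPairs {Z : Set ℝ} (hZ : Z.Finite) : (chainPairs Z).Finite := by
  refine ((hZ.prod hZ).toFinset.powerset.finite_toSet).subset fun P hP => ?_
  rw [Finset.mem_coe, Finset.mem_powerset]
  exact fun q hq => (Set.Finite.mem_toFinset _).2 (mem_of_mem_chainPairs hP hq)

/-- The `r`-variation as a supremum over sets of consecutive pairs. -/
theorem rVariation_eq_iSup_chainPairs {r : ℝ} (hr : 0 < r) (a : ℝ → ℂ) (Z : Set ℝ) :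
    rVariation r a Z = ⨆ P ∈ chainPairs Z, (∑ q ∈ P, ‖a q.2 - a q.1‖ₑ ^ r) ^ (1 / r) := by
  have hsum : ∀ (J : ℕ) (t : ℕ → ℝ), (∀ j < J, t j < t (j + 1)) →
      ∑ q ∈ (Finset.range J).image (fun j => (t j, t (j + 1))), ‖a q.2 - a q.1‖ₑ ^ r =
        ∑ j ∈ Finset.range J, ‖a (t (j + 1)) - a (t j)‖ₑ ^ r := fun J t ht => by
    refine Finset.sum_image fun i hi j hj hij => ?_
    have hlt : ∀ i j : ℕ, i < j → j < J → t i < t j := fun i j hij => by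
      induction j, hij using Nat.le_induction with
      | base => exact fun h => ht i (by omega)
      | succ k hk ih => exact fun h => (ih (by omega)).trans (ht k (by omega))
    have h1 : t i = t j := (Prod.ext_iff.1 hij).1
    rcases lt_trichotomy i j with h | h | h
    · exact absurd h1 (hlt i j h (Finset.mem_range.1 hj)).ne
    · exact h
    · exact absurd h1 (hlt j i h (Finset.mem_range.1 hi)).ne'
  apply le_antisymm
  · refine iSup_le fun J => iSup_le fun t => iSup_le fun ht => iSup_le fun hZ => ?_
    rw [← hsum J t ht]
    exact le_iSup₂_of_le _ ⟨J, t, ht, fun j hj => ⟨hZ j hj.le, hZ (j + 1) hj⟩, rfl⟩ le_rfl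
  · refine iSup₂_le fun P hP => ?_
    obtain ⟨J, t, ht, hZ, rfl⟩ := hP
    rw [hsum J t ht]
    rcases Nat.eq_zero_or_pos J with rfl | hJ
    · simp [hr]
    · refine le_iSup_of_le J <| le_iSup_of_le t <| le_iSup_of_le ht <| le_iSup_of_le ?_ le_rfl
      intro j hj
      rcases Nat.eq_zero_or_pos j with rfl | hj0
      · exact (hZ 0 hJ).1
      · obtain ⟨i, rfl⟩ : ∃ i, j = i + 1 := ⟨j - 1, by omega⟩
        exact (hZ i (by omega)).2

theorem rVariation_mono (r : ℝ) (a : ℝ → ℂ) {Z Z' : Set ℝ} (h : Z ⊆ Z') :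
    rVariation r a Z ≤ rVariation r a Z' :=
  iSup_mono fun _ => iSup_mono fun _ => iSup_mono fun _ =>
    iSup_mono' fun hZ => ⟨fun j hj => h (hZ j hj), le_rfl⟩

theorem rVariation_congr {r : ℝ} {a b : ℝ → ℂ} {Z : Set ℝ} (h : ∀ t ∈ Z, a t = b t) :
    rVariation r a Z = rVariation r b Z := by
  unfold rVariation
  refine iSup_congr fun J => iSup_congr fun t => iSup_congr fun _ => iSup_congr fun hZ => ?_
  congr 1
  refine Finset.sum_congr rfl fun j hj => ?_
  rw [Finset.mem_range] at hj
  rw [h _ (hZ j hj.le), h _ (hZ (j + 1) hj)]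

theorem rVariation_empty {r : ℝ} (a : ℝ → ℂ) : rVariation r a ∅ = 0 := by
  simp only [rVariation, mem_empty_iff_false, ENNReal.iSup_eq_zero]
  exact fun J t _ h => (h 0 (Nat.zero_le _)).elim

theorem rVariation_zero {r : ℝ} (hr : 0 < r) (Z : Set ℝ) : rVariation r (fun _ => 0) Z = 0 := by
  simp only [rVariation, sub_self, enorm_zero, ENNReal.zero_rpow_of_pos hr,
    Finset.sum_const_zero, ENNReal.iSup_eq_zero]
  exact fun _ _ _ _ => ENNReal.zero_rpow_of_pos (by positivity)

theorem rVariation_add_le {r : ℝ} (hr : 1 ≤ r) (a b : ℝ → ℂ) (Z : Set ℝ) :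
    rVariation r (fun t => a t + b t) Z ≤ rVariation r a Z + rVariation r b Z := by
  refine iSup_le fun J => iSup_le fun t => iSup_le fun ht => iSup_le fun hZ => ?_
  calc (∑ j ∈ Finset.range J, ‖a (t (j + 1)) + b (t (j + 1)) - (a (t j) + b (t j))‖ₑ ^ r) ^ (1 / r)
      ≤ (∑ j ∈ Finset.range J,
          (‖a (t (j + 1)) - a (t j)‖ₑ + ‖b (t (j + 1)) - b (t j)‖ₑ) ^ r) ^ (1 / r) := by
        gcongr with j
        rw [add_sub_add_comm]
        exact enorm_add_le _ _
    _ ≤ (∑ j ∈ Finset.range J, ‖a (t (j + 1)) - a (t j)‖ₑ ^ r) ^ (1 / r) +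
        (∑ j ∈ Finset.range J, ‖b (t (j + 1)) - b (t j)‖ₑ ^ r) ^ (1 / r) :=
        ENNReal.Lp_add_le _ _ _ hr
    _ ≤ _ := by
        gcongr
        · exact le_iSup_of_le J <| le_iSup_of_le t <| le_iSup_of_le ht <| le_iSup_of_le hZ le_rfl
        · exact le_iSup_of_le J <| le_iSup_of_le t <| le_iSup_of_le ht <| le_iSup_of_le hZ le_rfl

theorem rVariation_sum_le {r : ℝ} (hr : 1 ≤ r) {ι : Type*} (s : Finset ι) (a : ι → ℝ → ℂ)
    (Z : Set ℝ) :
    rVariation r (fun t => ∑ i ∈ s, a i t) Z ≤ ∑ i ∈ s, rVariation r (a i) Z := by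
  classical
  induction s using Finset.induction_on with
  | empty => simp [rVariation_zero (by linarith : 0 < r)]
  | insert i s his ih =>
    simp only [Finset.sum_insert his]
    exact (rVariation_add_le hr _ _ Z).trans (by gcongr)

theorem ENNReal.sum_rpow_rpow_le_sum {ι : Type*} (s : Finset ι) (x : ι → ℝ≥0∞) {r : ℝ}
    (hr : 1 ≤ r) : (∑ i ∈ s, x i ^ r) ^ (1 / r) ≤ ∑ i ∈ s, x i := by
  have hr0 : 0 < r := by linarith
  have h : ∑ i ∈ s, x i ^ r ≤ (∑ i ∈ s, x i) ^ r := by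
    classical
    induction s using Finset.induction_on with
    | empty => simp
    | insert i s his ih =>
      rw [Finset.sum_insert his, Finset.sum_insert his]
      exact (add_le_add_right ih _).trans (ENNReal.add_rpow_le_rpow_add _ _ hr)
  calc (∑ i ∈ s, x i ^ r) ^ (1 / r) ≤ ((∑ i ∈ s, x i) ^ r) ^ (1 / r) := by gcongr
    _ = _ := by rw [← ENNReal.rpow_mul, mul_one_div_cancel hr0.ne', ENNReal.rpow_one]

/-- A crude bound on a finite parameter set, whose constant depends on the set. -/
theorem rVariation_le_sum {r : ℝ} (hr : 1 ≤ r) (a : ℝ → ℂ) (F : Finset ℝ) :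
    rVariation r a F ≤ ∑ q ∈ F ×ˢ F, (‖a q.2‖ₑ + ‖a q.1‖ₑ) := by
  rw [rVariation_eq_iSup_chainPairs (by linarith)]
  refine iSup₂_le fun P hP => ?_
  refine (ENNReal.sum_rpow_rpow_le_sum P _ hr).trans ?_
  refine (Finset.sum_le_sum fun q _ => enorm_sub_le).trans
    (Finset.sum_le_sum_of_subset fun q hq => ?_)
  have := mem_of_mem_chainPairs hP hq
  rw [Finset.mem_product]
  exact ⟨this.1, this.2⟩

/-- The variation over an increasing union is the supremum of the variations. -/
theorem rVariation_iUnion_le (r : ℝ) (a : ℝ → ℂ) {Z : ℕ → Set ℝ} (hZ : Monotone Z) :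
    rVariation r a (⋃ m, Z m) ≤ ⨆ m, rVariation r a (Z m) := by
  refine iSup_le fun J => iSup_le fun t => iSup_le fun ht => iSup_le fun hmem => ?_
  have h : ∀ j, ∃ m, j ≤ J → t j ∈ Z m := fun j => by
    by_cases hj : j ≤ J
    · obtain ⟨m, hm⟩ := mem_iUnion.1 (hmem j hj)
      exact ⟨m, fun _ => hm⟩
    · exact ⟨0, fun h => absurd h hj⟩
  choose m hm using h
  refine le_iSup_of_le ((Finset.range (J + 1)).sup m) ?_
  refine le_iSup_of_le J <| le_iSup_of_le t <| le_iSup_of_le ht <| le_iSup_of_le ?_ le_rfl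
  exact fun j hj => hZ (Finset.le_sup (f := m) (Finset.mem_range.2 (by omega))) (hm j hj)

/-- The variation of a continuous function is determined by a dense subset. -/
theorem rVariation_le_of_dense {r : ℝ} {a : ℝ → ℂ} {Z Z' : Set ℝ} (hsub : Z' ⊆ Z)
    (hdense : Z ⊆ closure Z') (ha : ContinuousOn a Z) :
    rVariation r a Z ≤ rVariation r a Z' := by
  refine iSup_le fun J => iSup_le fun t => iSup_le fun ht => iSup_le fun hmem => ?_
  have h : ∀ j, ∃ u : ℕ → ℝ, j ≤ J → (∀ k, u k ∈ Z') ∧ Tendsto u atTop (𝓝 (t j)) := fun j => by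
    by_cases hj : j ≤ J
    · obtain ⟨u, hu⟩ := mem_closure_iff_seq_limit.1 (hdense (hmem j hj))
      exact ⟨u, fun _ => hu⟩
    · exact ⟨fun _ => 0, fun h => absurd h hj⟩
  choose u hu using h
  have hau : ∀ j ≤ J, Tendsto (fun k => a (u j k)) atTop (𝓝 (a (t j))) := fun j hj => by
    refine (ha (t j) (hmem j hj)).tendsto.comp ?_
    exact tendsto_nhdsWithin_iff.2 ⟨(hu j hj).2, Eventually.of_forall fun k => hsub ((hu j hj).1 k)⟩
  have hlim : Tendsto
      (fun k => (∑ j ∈ Finset.range J, ‖a (u (j + 1) k) - a (u j k)‖ₑ ^ r) ^ (1 / r))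
      atTop (𝓝 ((∑ j ∈ Finset.range J, ‖a (t (j + 1)) - a (t j)‖ₑ ^ r) ^ (1 / r))) := by
    refine (ENNReal.continuous_rpow_const.tendsto _).comp ?_
    refine tendsto_finsetSum _ fun j hj => ?_
    rw [Finset.mem_range] at hj
    exact (ENNReal.continuous_rpow_const.tendsto _).comp
      ((hau (j + 1) hj).sub (hau j hj.le)).enorm
  have hlt : ∀ᶠ k in atTop, ∀ j ∈ Finset.range J, u j k < u (j + 1) k := by
    rw [Filter.eventually_all_finset]
    intro j hj
    rw [Finset.mem_range] at hj
    exact (hu j hj.le).2.eventually_lt (hu (j + 1) hj).2 (ht j hj)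
  refine le_of_tendsto hlim ?_
  filter_upwards [hlt] with k hk
  exact le_iSup_of_le J <| le_iSup_of_le (fun j => u j k) <|
    le_iSup_of_le (fun j hj => hk j (Finset.mem_range.2 hj)) <|
    le_iSup_of_le (fun j hj => (hu j hj).1 k) le_rfl

theorem aemeasurable_rVariation {X : Type*} [MeasurableSpace X] {μ : Measure X} {r : ℝ}
    (hr : 0 < r) {a : ℝ → X → ℂ} {Z : Set ℝ} (hZ : Z.Finite) (ha : ∀ t ∈ Z, AEMeasurable (a t) μ) :
    AEMeasurable (fun x => rVariation r (fun t => a t x) Z) μ := by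
  simp only [rVariation_eq_iSup_chainPairs hr]
  refine AEMeasurable.biSup _ (finite_chainPairs hZ).countable fun P hP => ?_
  refine (Finset.aemeasurable_fun_sum _ fun q hq => ?_).pow_const _
  have := mem_of_mem_chainPairs hP hq
  exact ((ha _ this.2).sub (ha _ this.1)).enorm.pow_const _

/-! ### The `ℓ²` norm over the scales -/

theorem ellTwo_eq_lintegral (u : ℤ → ℝ≥0∞) :
    ellTwo u = (∫⁻ n, u n ^ (2 : ℝ) ∂Measure.count) ^ (1 / (2 : ℝ)) := by
  simp [ellTwo, lintegral_count]

theorem ellTwo_mono {u v : ℤ → ℝ≥0∞} (h : ∀ n, u n ≤ v n) : ellTwo u ≤ ellTwo v := by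
  unfold ellTwo
  gcongr with n
  exact h n

theorem ellTwo_zero : ellTwo (fun _ => 0) = 0 := by simp [ellTwo]

theorem ellTwo_add_le (u v : ℤ → ℝ≥0∞) : ellTwo (fun n => u n + v n) ≤ ellTwo u + ellTwo v := by
  simp only [ellTwo_eq_lintegral]
  exact ENNReal.lintegral_Lp_add_le (measurable_of_countable _).aemeasurable
    (measurable_of_countable _).aemeasurable (by norm_num)

theorem ellTwo_sum_le {ι : Type*} (s : Finset ι) (u : ι → ℤ → ℝ≥0∞) :
    ellTwo (fun n => ∑ i ∈ s, u i n) ≤ ∑ i ∈ s, ellTwo (u i) := by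
  classical
  induction s using Finset.induction_on with
  | empty => simp [ellTwo_zero]
  | insert i s his ih =>
    simp only [Finset.sum_insert his]
    exact (ellTwo_add_le _ _).trans (by gcongr)

theorem ellTwo_eq_sum {u : ℤ → ℝ≥0∞} {s : Finset ℤ} (hu : ∀ n ∉ s, u n = 0) :
    ellTwo u = (∑ n ∈ s, u n ^ 2) ^ (1 / 2 : ℝ) := by
  rw [ellTwo, tsum_eq_sum fun n hn => by simp [hu n hn]]

theorem ellTwo_le_sum {u : ℤ → ℝ≥0∞} {s : Finset ℤ} (hu : ∀ n ∉ s, u n = 0) :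
    ellTwo u ≤ ∑ n ∈ s, u n := by
  rw [ellTwo_eq_sum hu]
  simpa using ENNReal.sum_rpow_rpow_le_sum s u (r := 2) (by norm_num)

theorem ellTwo_comp_add_left (u : ℤ → ℝ≥0∞) (j : ℤ) : ellTwo (fun n => u (j + n)) = ellTwo u := by
  unfold ellTwo
  exact congrArg (· ^ (1 / 2 : ℝ)) ((Equiv.addLeft j).tsum_eq fun n => u n ^ 2)

theorem ellTwo_iSup {u : ℕ → ℤ → ℝ≥0∞} (hu : Monotone u) :
    ellTwo (fun n => ⨆ m, u m n) = ⨆ m, ellTwo (u m) := by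
  simp only [ellTwo_eq_lintegral]
  have h1 : ∀ v : ℕ → ℝ≥0∞, ∀ r : ℝ, 0 < r → (⨆ m, v m) ^ r = ⨆ m, v m ^ r := fun v r hr =>
    (ENNReal.orderIsoRpow r hr).map_iSup v
  simp only [h1 _ 2 two_pos]
  rw [lintegral_iSup (fun _ => measurable_of_countable _) fun m m' h n => by
    exact ENNReal.rpow_le_rpow (hu h n) two_pos.le, h1 _ _ (by norm_num)]

theorem AEMeasurable.ellTwo {X : Type*} [MeasurableSpace X] {μ : Measure X} {u : ℤ → X → ℝ≥0∞}
    (hu : ∀ n, AEMeasurable (u n) μ) : AEMeasurable (fun x => ellTwo fun n => u n x) μ :=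
  (AEMeasurable.tsum fun n => (hu n).pow_const 2).pow_const _

/-! ### Real interpolation between `L^s` and `L^2` -/

theorem lintegral_Ioi_rpow_lt {c e : ℝ} (hc : 0 ≤ c) (he : -1 < e) :
    ∫⁻ t in Ioi (0 : ℝ), (if t < c then ENNReal.ofReal (t ^ e) else 0) =
      ENNReal.ofReal (c ^ (e + 1) / (e + 1)) := by
  have h1 : ∀ t : ℝ, (if t < c then ENNReal.ofReal (t ^ e) else 0) =
      (Iio c).indicator (fun t => ENNReal.ofReal (t ^ e)) t := fun t => by
    simp [indicator_apply]
  simp only [h1]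
  rw [lintegral_indicator measurableSet_Iio, Measure.restrict_restrict measurableSet_Iio,
    inter_comm, Ioi_inter_Iio, restrict_Ioo_eq_restrict_Ioc]
  have hint : IntegrableOn (fun t : ℝ => t ^ e) (Ioc 0 c) :=
    (intervalIntegrable_iff_integrableOn_Ioc_of_le hc).1
      (intervalIntegral.intervalIntegrable_rpow' he)
  rw [← ofReal_integral_eq_lintegral_ofReal hint, ← intervalIntegral.integral_of_le hc,
    integral_rpow (Or.inl he), Real.zero_rpow (by linarith), sub_zero]
  filter_upwards [ae_restrict_mem measurableSet_Ioc] with t ht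
  exact Real.rpow_nonneg ht.1.le _

theorem lintegral_Ioi_rpow_ge {c e : ℝ} (hc : 0 < c) (he : e < -1) :
    ∫⁻ t in Ioi (0 : ℝ), (if c ≤ t then ENNReal.ofReal (t ^ e) else 0) =
      ENNReal.ofReal (-c ^ (e + 1) / (e + 1)) := by
  have h1 : ∀ t : ℝ, (if c ≤ t then ENNReal.ofReal (t ^ e) else 0) =
      (Ici c).indicator (fun t => ENNReal.ofReal (t ^ e)) t := fun t => by
    simp [indicator_apply]
  simp only [h1]
  rw [lintegral_indicator measurableSet_Ici, Measure.restrict_restrict measurableSet_Ici,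
    inter_eq_left.2 (show Ici c ⊆ Ioi 0 from fun t ht => hc.trans_le ht),
    ← restrict_Ioi_eq_restrict_Ici,
    ← integral_Ioi_rpow_of_lt he hc, ofReal_integral_eq_lintegral_ofReal
      (integrableOn_Ioi_rpow_of_lt he hc)]
  filter_upwards [ae_restrict_mem measurableSet_Ioi] with t ht
  exact Real.rpow_nonneg (hc.trans ht).le _

/-- Real interpolation: integration of a weak-type bound that estimates the part of `y` above
the height `t / b` in `L^s` and the part below this height in `L^2`. -/
theorem lintegral_rpow_le_of_weak_bound {X : Type*} [MeasurableSpace X] {μ : Measure X}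
    [SigmaFinite μ] {s p b : ℝ} (hs : 0 < s) (hsp : s < p) (hp : p < 2) (hb : 0 < b)
    {A : ℝ≥0∞} {u : X → ℝ≥0∞} (hu : AEMeasurable u μ) (hfin : ∀ x, u x ≠ ∞) {y : X → ℝ}
    (hy : AEMeasurable y μ) (hy0 : ∀ x, 0 ≤ y x)
    (h : ∀ t : ℝ, 0 < t → μ {x | ENNReal.ofReal (2 * t) < u x} ≤
      ENNReal.ofReal (t ^ (-s)) *
        (A * ∫⁻ x, (if t < b * y x then ENNReal.ofReal (y x ^ s) else 0) ∂μ) +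
      ENNReal.ofReal (t ^ (-2 : ℝ)) * (ENNReal.ofReal (b ^ 2) *
        ∫⁻ x, (if b * y x ≤ t then ENNReal.ofReal (y x ^ 2) else 0) ∂μ)) :
    ∫⁻ x, u x ^ p ∂μ ≤ ENNReal.ofReal (2 ^ p * p) *
      (A * ENNReal.ofReal (b ^ (p - s) / (p - s)) + ENNReal.ofReal (b ^ p / (2 - p))) *
      ∫⁻ x, ENNReal.ofReal (y x ^ p) ∂μ := by
  have hp0 : 0 < p := hs.trans hsp
  have hmeas1 : Measurable fun q : ℝ × ℝ => (if q.1 < b * q.2 then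
      ENNReal.ofReal (q.1 ^ (p - 1 - s)) * ENNReal.ofReal (q.2 ^ s) else 0) := by
    refine Measurable.ite (measurableSet_lt measurable_fst (measurable_snd.const_mul b)) ?_
      measurable_const
    fun_prop
  have hmeas2 : Measurable fun q : ℝ × ℝ => (if b * q.2 ≤ q.1 then
      ENNReal.ofReal (q.1 ^ (p - 3)) * ENNReal.ofReal (q.2 ^ 2) else 0) := by
    refine Measurable.ite (measurableSet_le (measurable_snd.const_mul b) measurable_fst) ?_
      measurable_const
    fun_prop
  have hpair : AEMeasurable (fun q : ℝ × X => (q.1, y q.2))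
      ((volume.restrict (Ioi (0 : ℝ))).prod μ) :=
    measurable_fst.aemeasurable.prodMk hy.comp_snd
  have hF1 : AEMeasurable (Function.uncurry fun (t : ℝ) (x : X) => if t < b * y x then
      ENNReal.ofReal (t ^ (p - 1 - s)) * ENNReal.ofReal (y x ^ s) else 0)
      ((volume.restrict (Ioi (0 : ℝ))).prod μ) := hmeas1.comp_aemeasurable hpair
  have hF2 : AEMeasurable (Function.uncurry fun (t : ℝ) (x : X) => if b * y x ≤ t then
      ENNReal.ofReal (t ^ (p - 3)) * ENNReal.ofReal (y x ^ 2) else 0)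
      ((volume.restrict (Ioi (0 : ℝ))).prod μ) := hmeas2.comp_aemeasurable hpair
  have hI1 : ∫⁻ t in Ioi (0 : ℝ), ∫⁻ x, (if t < b * y x then
      ENNReal.ofReal (t ^ (p - 1 - s)) * ENNReal.ofReal (y x ^ s) else 0) ∂μ =
      ENNReal.ofReal (b ^ (p - s) / (p - s)) * ∫⁻ x, ENNReal.ofReal (y x ^ p) ∂μ := by
    rw [lintegral_lintegral_swap hF1,
      ← lintegral_const_mul' _ _ ENNReal.ofReal_ne_top]
    refine lintegral_congr fun x => ?_
    have h1 : ∀ t : ℝ, (if t < b * y x then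
        ENNReal.ofReal (t ^ (p - 1 - s)) * ENNReal.ofReal (y x ^ s) else 0) =
        (if t < b * y x then ENNReal.ofReal (t ^ (p - 1 - s)) else 0) *
          ENNReal.ofReal (y x ^ s) := fun t => by split_ifs <;> simp
    simp only [h1]
    rw [lintegral_mul_const' _ _ ENNReal.ofReal_ne_top,
      lintegral_Ioi_rpow_lt (mul_nonneg hb.le (hy0 x)) (by linarith),
      show p - 1 - s + 1 = p - s by ring, Real.mul_rpow hb.le (hy0 x),
      ← ENNReal.ofReal_mul' (Real.rpow_nonneg (hy0 x) _),
      ← ENNReal.ofReal_mul' (Real.rpow_nonneg (hy0 x) _)]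
    congr 1
    have : y x ^ p = y x ^ (p - s) * y x ^ s := by
      rw [← Real.rpow_add_of_nonneg (hy0 x) (by linarith) hs.le]; congr 1; ring
    rw [this]; ring
  have hI2 : ∫⁻ t in Ioi (0 : ℝ), ∫⁻ x, (if b * y x ≤ t then
      ENNReal.ofReal (t ^ (p - 3)) * ENNReal.ofReal (y x ^ 2) else 0) ∂μ =
      ENNReal.ofReal (b ^ (p - 2) / (2 - p)) * ∫⁻ x, ENNReal.ofReal (y x ^ p) ∂μ := by
    rw [lintegral_lintegral_swap hF2,
      ← lintegral_const_mul' _ _ ENNReal.ofReal_ne_top]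
    refine lintegral_congr fun x => ?_
    rcases (hy0 x).eq_or_lt with h0 | h0
    · simp [← h0, Real.zero_rpow hp0.ne']
    have h1 : ∀ t : ℝ, (if b * y x ≤ t then
        ENNReal.ofReal (t ^ (p - 3)) * ENNReal.ofReal (y x ^ 2) else 0) =
        (if b * y x ≤ t then ENNReal.ofReal (t ^ (p - 3)) else 0) *
          ENNReal.ofReal (y x ^ 2) := fun t => by split_ifs <;> simp
    simp only [h1]
    rw [lintegral_mul_const' _ _ ENNReal.ofReal_ne_top,
      lintegral_Ioi_rpow_ge (mul_pos hb h0) (by linarith),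
      show p - 3 + 1 = p - 2 by ring, Real.mul_rpow hb.le (hy0 x),
      ← ENNReal.ofReal_mul' (sq_nonneg _), ← ENNReal.ofReal_mul' (Real.rpow_nonneg (hy0 x) _)]
    congr 1
    have : y x ^ p = y x ^ (p - 2) * y x ^ 2 := by
      rw [← Real.rpow_two, ← Real.rpow_add h0]; congr 1; ring
    have h2 : p - 2 ≠ 0 := by linarith
    have h3 : 2 - p ≠ 0 := by linarith
    rw [this, ← neg_sub p 2]; field_simp
  -- the layer-cake formula for `u / 2`
  set w : X → ℝ := fun x => (u x).toReal / 2 with hw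
  have hw0 : ∀ x, 0 ≤ w x := fun x => by positivity
  have huw : ∀ x, u x ^ p = ENNReal.ofReal (2 ^ p) * ENNReal.ofReal (w x ^ p) := fun x => by
    rw [← ENNReal.ofReal_mul (by positivity), ← Real.mul_rpow (by norm_num) (hw0 x),
      show 2 * w x = (u x).toReal by simp [hw]; ring,
      ← ENNReal.ofReal_rpow_of_nonneg ENNReal.toReal_nonneg hp0.le, ENNReal.ofReal_toReal (hfin x)]
  have hset : ∀ t : ℝ, 0 < t → {x | t < w x} = {x | ENNReal.ofReal (2 * t) < u x} := by
    intro t ht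
    ext x
    simp only [mem_ofPred_eq, hw]
    rw [ENNReal.ofReal_lt_iff_lt_toReal (by positivity) (hfin x), lt_div_iff₀ two_pos, mul_comm]
  simp only [huw]
  rw [lintegral_const_mul' _ _ ENNReal.ofReal_ne_top,
    lintegral_rpow_eq_lintegral_meas_lt_mul μ (ae_of_all _ hw0)
      (hu.ennreal_toReal.div_const 2) hp0]
  have hkey : ∫⁻ t in Ioi (0 : ℝ), μ {x | t < w x} * ENNReal.ofReal (t ^ (p - 1)) ≤
      ∫⁻ t in Ioi (0 : ℝ), (A * (∫⁻ x, (if t < b * y x then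
        ENNReal.ofReal (t ^ (p - 1 - s)) * ENNReal.ofReal (y x ^ s) else 0) ∂μ) +
      ENNReal.ofReal (b ^ 2) * ∫⁻ x, (if b * y x ≤ t then
        ENNReal.ofReal (t ^ (p - 3)) * ENNReal.ofReal (y x ^ 2) else 0) ∂μ) := by
    refine setLIntegral_mono' measurableSet_Ioi fun t ht => ?_
    have ht : 0 < t := ht
    rw [hset t ht]
    refine (mul_le_mul_left (h t ht) _).trans_eq ?_
    have e1 : ∀ x, (if t < b * y x then
        ENNReal.ofReal (t ^ (p - 1 - s)) * ENNReal.ofReal (y x ^ s) else 0) =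
        ENNReal.ofReal (t ^ (p - 1 - s)) *
          (if t < b * y x then ENNReal.ofReal (y x ^ s) else 0) := fun x => by
      split_ifs <;> simp
    have e2 : ∀ x, (if b * y x ≤ t then
        ENNReal.ofReal (t ^ (p - 3)) * ENNReal.ofReal (y x ^ 2) else 0) =
        ENNReal.ofReal (t ^ (p - 3)) *
          (if b * y x ≤ t then ENNReal.ofReal (y x ^ 2) else 0) := fun x => by
      split_ifs <;> simp
    simp only [e1, e2]
    rw [lintegral_const_mul' _ _ ENNReal.ofReal_ne_top,
      lintegral_const_mul' _ _ ENNReal.ofReal_ne_top]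
    have e3 : ENNReal.ofReal (t ^ (p - 1 - s)) =
        ENNReal.ofReal (t ^ (-s)) * ENNReal.ofReal (t ^ (p - 1)) := by
      rw [← ENNReal.ofReal_mul (by positivity), ← Real.rpow_add ht]; congr 2; ring
    have e4 : ENNReal.ofReal (t ^ (p - 3)) =
        ENNReal.ofReal (t ^ (-2 : ℝ)) * ENNReal.ofReal (t ^ (p - 1)) := by
      rw [← ENNReal.ofReal_mul (by positivity), ← Real.rpow_add ht]; congr 2; ring
    rw [e3, e4]; ring
  have hG1 : AEMeasurable (fun t : ℝ => ∫⁻ x, (if t < b * y x then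
      ENNReal.ofReal (t ^ (p - 1 - s)) * ENNReal.ofReal (y x ^ s) else 0) ∂μ)
      (volume.restrict (Ioi (0 : ℝ))) := hF1.lintegral_prod_right'
  rw [lintegral_add_left' (hG1.const_mul A), lintegral_const_mul'' _ hG1,
    lintegral_const_mul' _ _ ENNReal.ofReal_ne_top] at hkey
  rw [hI1, hI2] at hkey
  refine (mul_le_mul_right (mul_le_mul_right hkey _) _).trans_eq ?_
  have e5 : ENNReal.ofReal (b ^ p / (2 - p)) =
      ENNReal.ofReal (b ^ 2) * ENNReal.ofReal (b ^ (p - 2) / (2 - p)) := by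
    rw [← ENNReal.ofReal_mul (by positivity), ← mul_div_assoc, ← Real.rpow_two,
      ← Real.rpow_add hb]
    congr 3; ring
  rw [e5, ENNReal.ofReal_mul (by positivity)]
  ring

/-- Real interpolation, strong-type form: if `u` is controlled by a part coming from the large
values of `f`, bounded in `L^s`, and a part coming from its small values, bounded in `L^2` with
a constant `b`, then the `L^p` norm of `u` is controlled with a constant that tends to zero
with `b`. -/
theorem lintegral_rpow_le_of_truncation {X : Type*} [MeasurableSpace X] {μ : Measure X}
    [SigmaFinite μ] {s p b : ℝ} (hs : 0 < s) (hsp : s < p) (hp : p < 2) (hb : 0 < b)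
    {A : ℝ≥0∞} {u : X → ℝ≥0∞} (hu : AEMeasurable u μ) (hfin : ∀ x, u x ≠ ∞) {f : X → ℂ}
    (hf : AEMeasurable f μ)
    (h : ∀ l : ℝ, 0 < l → ∃ u₁ u₂ : X → ℝ≥0∞, AEMeasurable u₁ μ ∧ AEMeasurable u₂ μ ∧
      (∀ᵐ x ∂μ, u x ≤ u₁ x + u₂ x) ∧
      ∫⁻ x, u₁ x ^ s ∂μ ≤ A * ∫⁻ x, ‖{x | l < ‖f x‖}.indicator f x‖ₑ ^ s ∂μ ∧
      ∫⁻ x, u₂ x ^ (2 : ℝ) ∂μ ≤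
        ENNReal.ofReal (b ^ 2) * ∫⁻ x, ‖{x | ‖f x‖ ≤ l}.indicator f x‖ₑ ^ (2 : ℝ) ∂μ) :
    ∫⁻ x, u x ^ p ∂μ ≤ ENNReal.ofReal (2 ^ p * p) *
      (A * ENNReal.ofReal (b ^ (p - s) / (p - s)) + ENNReal.ofReal (b ^ p / (2 - p))) *
      ∫⁻ x, ‖f x‖ₑ ^ p ∂μ := by
  have hp0 : 0 < p := hs.trans hsp
  have hpow : ∀ (r : ℝ), 0 ≤ r → ∀ z : ℂ, ENNReal.ofReal (‖z‖ ^ r) = ‖z‖ₑ ^ r := fun r hr z => by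
    rw [← ENNReal.ofReal_rpow_of_nonneg (norm_nonneg _) hr, ofReal_norm]
  simp only [← hpow p hp0.le]
  refine lintegral_rpow_le_of_weak_bound hs hsp hp hb hu hfin hf.norm (fun x => norm_nonneg _) ?_
  intro t ht
  obtain ⟨u₁, u₂, hu1, hu2, hle, hb1, hb2⟩ := h (t / b) (by positivity)
  have hcheb : ∀ (v : X → ℝ≥0∞) (r : ℝ), 0 < r → AEMeasurable v μ →
      μ {x | ENNReal.ofReal t ≤ v x} ≤ ENNReal.ofReal (t ^ (-r)) * ∫⁻ x, v x ^ r ∂μ := by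
    intro v r hr hv
    have h1 := mul_meas_ge_le_lintegral₀ (hv.pow_const r) (ENNReal.ofReal t ^ r)
    have h2 : {x | ENNReal.ofReal t ^ r ≤ v x ^ r} = {x | ENNReal.ofReal t ≤ v x} := by
      ext x; exact ENNReal.rpow_le_rpow_iff hr
    rw [h2] at h1
    have h3 : ENNReal.ofReal (t ^ (-r)) * ENNReal.ofReal t ^ r = 1 := by
      rw [ENNReal.ofReal_rpow_of_pos ht, ← ENNReal.ofReal_mul (by positivity),
        ← Real.rpow_add ht]
      simp
    calc μ {x | ENNReal.ofReal t ≤ v x}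
        = ENNReal.ofReal (t ^ (-r)) *
          (ENNReal.ofReal t ^ r * μ {x | ENNReal.ofReal t ≤ v x}) := by
          rw [← mul_assoc, h3, one_mul]
      _ ≤ _ := by gcongr
  have hsub : μ {x | ENNReal.ofReal (2 * t) < u x} ≤
      μ {x | ENNReal.ofReal t ≤ u₁ x} + μ {x | ENNReal.ofReal t ≤ u₂ x} := by
    refine le_trans (measure_mono_ae ?_) (measure_union_le _ _)
    filter_upwards [hle] with x hx hlt
    by_contra hcon
    have h1 : ¬ (ENNReal.ofReal t ≤ u₁ x ∨ ENNReal.ofReal t ≤ u₂ x) := hcon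
    push Not at h1
    have h2 : ENNReal.ofReal (2 * t) < u x := hlt
    rw [two_mul, ENNReal.ofReal_add ht.le ht.le] at h2
    exact absurd (h2.trans_le hx) (not_lt.2 (add_le_add h1.1.le h1.2.le))
  refine hsub.trans (add_le_add ((hcheb u₁ s hs hu1).trans ?_) ((hcheb u₂ 2 two_pos hu2).trans ?_))
  · refine mul_le_mul_right (hb1.trans_eq ?_) _
    congr 1
    refine lintegral_congr fun x => ?_
    rw [indicator_apply]
    simp only [mem_ofPred_eq, div_lt_iff₀' hb]
    split_ifs
    · exact (hpow s hs.le _).symm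
    · simp [hs]
  · refine mul_le_mul_right (hb2.trans_eq ?_) _
    congr 1
    refine lintegral_congr fun x => ?_
    rw [indicator_apply]
    simp only [mem_ofPred_eq, le_div_iff₀' hb]
    split_ifs
    · rw [← Real.rpow_two, hpow 2 two_pos.le]
    · simp

/-! ### Vector-valued bound for the variations over the blocks -/

theorem eLpNorm_le_mul_eLpNorm_iff {X : Type*} [MeasurableSpace X] {μ : Measure X}
    {E F : Type*} [TopologicalSpace E] [ContinuousENorm E] [TopologicalSpace F] [ContinuousENorm F]
    {s : ℝ} (hs : 0 < s) (u : X → E) (v : X → F) (C : ℝ≥0∞) :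
    eLpNorm u (ENNReal.ofReal s) μ ≤ C * eLpNorm v (ENNReal.ofReal s) μ ↔
      ∫⁻ x, ‖u x‖ₑ ^ s ∂μ ≤ C ^ s * ∫⁻ x, ‖v x‖ₑ ^ s ∂μ := by
  have h0 : ENNReal.ofReal s ≠ 0 := by simpa using hs
  rw [eLpNorm_eq_lintegral_rpow_enorm_toReal h0 ENNReal.ofReal_ne_top,
    eLpNorm_eq_lintegral_rpow_enorm_toReal h0 ENNReal.ofReal_ne_top, ENNReal.toReal_ofReal hs.le,
    ← ENNReal.rpow_le_rpow_iff hs, ENNReal.mul_rpow_of_nonneg _ _ hs.le, ← ENNReal.rpow_mul,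
    ← ENNReal.rpow_mul, one_div_mul_cancel hs.ne', ENNReal.rpow_one, ENNReal.rpow_one]

/-- A positive operator is dominated, up to the factor `2`, by its action on a majorant: the factor
comes from the separate treatment of real and imaginary parts. -/
theorem IsPositiveLinearOperator.enorm_le {X : Type*} [MeasurableSpace X] {μ : Measure X}
    {T : (X → ℂ) → (X → ℂ)} (hT : IsPositiveLinearOperator μ T) {p : ℝ≥0∞} (hp : 1 ≤ p)
    {f : X → ℂ} {G : X → ℝ} (hf : MemLp f p μ) (hG : MemLp G p μ) (h : ∀ x, ‖f x‖ ≤ G x) :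
    ∀ᵐ x ∂μ, ‖T f x‖ₑ ≤ 2 * ‖T (fun x => (G x : ℂ)) x‖ₑ := by
  have hpI : p ∈ Set.Icc (1 : ℝ≥0∞) ⊤ := ⟨hp, le_top⟩
  set Gc : X → ℂ := fun x => (G x : ℂ) with hGc
  have hGcm : MemLp Gc p μ := hG.ofReal
  have hreal : ∀ y : X → ℝ, MemLp y p μ → (∀ x, |y x| ≤ G x) →
      ∀ᵐ x ∂μ, ‖T (fun x => (y x : ℂ)) x‖ ≤ ‖T Gc x‖ := by
    intro y hy hle
    set yc : X → ℂ := fun x => (y x : ℂ) with hyc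
    have hycm : MemLp yc p μ := hy.ofReal
    have h1 := hT.nonneg p hpI (Gc + yc) (hGcm.add hycm) (ae_of_all _ fun x => by
      have := neg_abs_le (y x)
      simp only [Pi.add_apply, hGc, hyc, ← Complex.ofReal_add, Complex.zero_le_real]
      linarith [hle x])
    have h2 := hT.nonneg p hpI (Gc - yc) (hGcm.sub hycm) (ae_of_all _ fun x => by
      have := le_abs_self (y x)
      simp only [Pi.sub_apply, hGc, hyc, ← Complex.ofReal_sub, Complex.zero_le_real]
      linarith [hle x])
    filter_upwards [h1, h2, hT.linear.map_add p hpI _ _ hGcm hycm,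
      hT.linear.map_sub hpI hGcm hycm] with x h1 h2 h3 h4
    rw [h3, Pi.add_apply, Complex.nonneg_iff] at h1
    rw [h4, Pi.sub_apply, Complex.nonneg_iff] at h2
    simp only [Complex.add_re, Complex.add_im, Complex.sub_re, Complex.sub_im] at h1 h2
    have i1 : (T yc x).im = 0 := by linarith [h1.2, h2.2]
    have i2 : (T Gc x).im = 0 := by linarith [h1.2, h2.2]
    have e1 : T yc x = ((T yc x).re : ℂ) := Complex.ext (by simp) (by simp [i1])
    have e2 : T Gc x = ((T Gc x).re : ℂ) := Complex.ext (by simp) (by simp [i2])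
    rw [e1, e2, Complex.norm_real, Complex.norm_real, Real.norm_eq_abs, Real.norm_eq_abs]
    refine (abs_le.2 ⟨?_, ?_⟩).trans (le_abs_self _) <;> linarith [h1.1, h2.1]
  have hre : MemLp (fun x => (f x).re) p μ := hf.re
  have him : MemLp (fun x => (f x).im) p μ := hf.im
  have hrec : MemLp (fun x => ((f x).re : ℂ)) p μ := hre.ofReal
  have himc : MemLp (fun x => ((f x).im : ℂ)) p μ := him.ofReal
  have hdec : f = (fun x => ((f x).re : ℂ)) + Complex.I • fun x => ((f x).im : ℂ) := by
    ext x
    simp [mul_comm Complex.I, Complex.re_add_im]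
  have h1 := hT.linear.map_add p hpI _ _ hrec (himc.const_smul Complex.I)
  have h2 := hT.linear.map_smul p hpI Complex.I _ himc
  rw [← hdec] at h1
  filter_upwards [h1, h2, hreal _ hre fun x => (Complex.abs_re_le_norm _).trans (h x),
    hreal _ him fun x => (Complex.abs_im_le_norm _).trans (h x)] with x h1 h2 h3 h4
  rw [h1, Pi.add_apply, h2, Pi.smul_apply, two_mul]
  refine (enorm_add_le _ _).trans (add_le_add ?_ ?_)
  · exact enorm_le_iff_norm_le.2 h3
  · rw [smul_eq_mul]
    exact enorm_le_iff_norm_le.2 (by rw [norm_mul, Complex.norm_I, one_mul]; exact h4)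

/-- Measurable choice of a maximiser from a finite family of functions. -/
theorem exists_measurable_argmax {X α : Type*} [MeasurableSpace X] {S : Set α} (hS : S.Finite)
    (hne : S.Nonempty) (φ : α → X → ℝ≥0∞) (hφ : ∀ i ∈ S, Measurable (φ i)) :
    ∃ P : X → α, (∀ x, P x ∈ S) ∧ (∀ x, ∀ i ∈ S, φ i x ≤ φ (P x) x) ∧
      ∀ i, MeasurableSet {x | P x = i} := by
  classical
  induction S, hS using Set.Finite.induction_on with
  | empty => exact absurd hne not_nonempty_empty
  | @insert a S ha hS ih =>
    rcases S.eq_empty_or_nonempty with rfl | hne'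
    · exact ⟨fun _ => a, by simp, by simp, fun i => MeasurableSet.const _⟩
    obtain ⟨P, hP, hmax, hmeas⟩ := ih hne' fun i hi => hφ i (mem_insert_of_mem _ hi)
    have hE : MeasurableSet {x | φ a x ≤ φ (P x) x} := by
      have : {x | φ a x ≤ φ (P x) x} = ⋃ i ∈ S, {x | P x = i} ∩ {x | φ a x ≤ φ i x} := by
        ext x
        simp only [mem_ofPred_eq, mem_iUnion, mem_inter_iff, exists_prop]
        constructor
        · exact fun h => ⟨P x, hP x, rfl, h⟩
        · rintro ⟨i, -, rfl, h⟩; exact h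
      rw [this]
      exact hS.measurableSet_biUnion fun i hi => (hmeas i).inter
        (measurableSet_le (hφ a (mem_insert _ _)) (hφ i (mem_insert_of_mem _ hi)))
    refine ⟨fun x => if φ a x ≤ φ (P x) x then P x else a, fun x => ?_, fun x i hi => ?_,
      fun i => ?_⟩
    · dsimp only
      split_ifs
      exacts [mem_insert_of_mem _ (hP x), mem_insert _ _]
    · dsimp only
      rcases mem_insert_iff.1 hi with rfl | hi
      · split_ifs with h
        exacts [h, le_rfl]
      · split_ifs with h
        exacts [hmax x i hi, (hmax x i hi).trans (not_le.1 h).le]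
    · have : {x | (if φ a x ≤ φ (P x) x then P x else a) = i} =
          ({x | φ a x ≤ φ (P x) x} ∩ {x | P x = i}) ∪
            ({x | φ a x ≤ φ (P x) x}ᶜ ∩ {_x | a = i}) := by
        ext x
        simp only [mem_ofPred_eq, mem_union, mem_inter_iff, mem_compl_iff]
        split_ifs with h <;> simp [h]
      rw [this]
      exact (hE.inter (hmeas i)).union (hE.compl.inter (MeasurableSet.const _))

/-- A finite set of positive parameters meets only finitely many dyadic blocks. -/
theorem exists_finset_dyadicBlock_eq_empty {Z : Set ℝ} (hZ : Z.Finite) (hpos : Z ⊆ Ioi 0) :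
    ∃ s : Finset ℤ, ∀ n ∉ s, dyadicBlock Z n = ∅ := by
  refine ⟨(hZ.toFinset.image fun t => Int.log 2 t), fun n hn => ?_⟩
  refine eq_empty_of_forall_notMem fun t ht => hn ?_
  refine Finset.mem_image.2 ⟨t, hZ.mem_toFinset.2 ht.2, ?_⟩
  have ht0 : 0 < t := hpos ht.2
  apply le_antisymm
  · have := (Int.lt_zpow_iff_log_lt (b := 2) one_lt_two ht0).1 (by exact_mod_cast ht.1.2)
    omega
  · exact (Int.zpow_le_iff_le_log (b := 2) one_lt_two ht0).1 (by exact_mod_cast ht.1.1)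

theorem dyadicBlock_subset (Z : Set ℝ) (n : ℤ) : dyadicBlock Z n ⊆ Z := inter_subset_right

theorem dyadicBlock_mono {Z Z' : Set ℝ} (h : Z ⊆ Z') (n : ℤ) :
    dyadicBlock Z n ⊆ dyadicBlock Z' n := inter_subset_inter_right _ h

/-- The vector-valued bound: the variations over the blocks of different functions `g n` are
controlled in `L^s(ℓ²)` by the square function of the `g n`. -/
theorem lintegral_ellTwo_rVariation_le {X : Type*} [MeasurableSpace X] {μ : Measure X} {s : ℝ}
    (hs1 : 1 < s) (hs2 : s ≤ 2) {Z : Set ℝ} (hZ : Z.Finite) (hpos : Z ⊆ Ioi 0)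
    {T : ℝ → (X → ℂ) → (X → ℂ)} (hT : ∀ t ∈ Z, IsPositiveLinearOperator μ (T t)) {C₂ C₃ : ℝ≥0}
    (hmax : ∀ f : X → ℂ, MemLp f (ENNReal.ofReal s) μ →
      ∫⁻ x, (⨆ t ∈ Z, ‖T t f x‖ₑ) ^ s ∂μ ≤ (C₂ : ℝ≥0∞) ^ s * ∫⁻ x, ‖f x‖ₑ ^ s ∂μ)
    (hvar : ∀ n : ℤ, ∀ f : X → ℂ, MemLp f (ENNReal.ofReal s) μ →
      ∫⁻ x, rVariation s (fun t => T t f x) (dyadicBlock Z n) ^ s ∂μ ≤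
        (C₃ : ℝ≥0∞) ^ s * ∫⁻ x, ‖f x‖ₑ ^ s ∂μ)
    (g : ℤ → X → ℂ) (hg : ∀ n, MemLp (g n) (ENNReal.ofReal s) μ) :
    ∫⁻ x, ellTwo (fun n => rVariation 2 (fun t => T t (g n) x) (dyadicBlock Z n)) ^ s ∂μ ≤
      (4 * (C₃ + 4 * C₂ : ℝ≥0) : ℝ≥0∞) ^ s * ∫⁻ x, ellTwo (fun n => ‖g n x‖ₑ) ^ s ∂μ := by
  classical
  have hs0 : 0 < s := by linarith
  have hpE : ENNReal.ofReal s ∈ Set.Icc (1 : ℝ≥0∞) ⊤ := ⟨by simpa using hs1.le, le_top⟩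
  have hmeas : ∀ f : X → ℂ, MemLp f (ENNReal.ofReal s) μ → ∀ t ∈ Z, AEMeasurable (T t f) μ :=
    fun f hf t ht => ((hT t ht).linear.aestronglyMeasurable _ hpE f hf).aemeasurable
  obtain ⟨B, hB⟩ := exists_finset_dyadicBlock_eq_empty hZ hpos
  set Zf : Finset ℝ := hZ.toFinset
  have hmemZf : ∀ t, t ∈ Zf ↔ t ∈ Z := fun t => hZ.mem_toFinset
  -- measurable representatives of the functions `T t (g n)`
  have hrep : ∀ (n : ℤ) (t : ℝ), ∃ b : X → ℂ, Measurable b ∧ (t ∈ Z → T t (g n) =ᵐ[μ] b) := by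
    intro n t
    by_cases ht : t ∈ Z
    · exact ⟨(hmeas _ (hg n) t ht).mk _, (hmeas _ (hg n) t ht).measurable_mk,
        fun _ => (hmeas _ (hg n) t ht).ae_eq_mk⟩
    · exact ⟨fun _ => 0, measurable_const, fun h => absurd h ht⟩
  choose b hbmeas hbeq using hrep
  -- a measurable choice of the sequence that realises the `2`-variation
  have harg : ∀ n : ℤ, ∃ P : X → Finset (ℝ × ℝ), (∀ x, P x ∈ chainPairs (dyadicBlock Z n)) ∧
      (∀ x, ∀ Q ∈ chainPairs (dyadicBlock Z n), ∑ q ∈ Q, ‖b n q.2 x - b n q.1 x‖ₑ ^ (2 : ℝ) ≤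
        ∑ q ∈ P x, ‖b n q.2 x - b n q.1 x‖ₑ ^ (2 : ℝ)) ∧
      ∀ Q, MeasurableSet {x | P x = Q} := fun n =>
    exists_measurable_argmax (finite_chainPairs (hZ.subset (dyadicBlock_subset Z n)))
      ⟨∅, empty_mem_chainPairs _⟩ (fun Q x => ∑ q ∈ Q, ‖b n q.2 x - b n q.1 x‖ₑ ^ (2 : ℝ))
      fun Q _ => Finset.measurable_fun_sum _ fun q _ =>
        ((hbmeas n q.2).sub (hbmeas n q.1)).enorm.pow_const _
  choose P hPmem hPmax hPmeas using harg
  have hPsub : ∀ n x, P n x ⊆ Zf ×ˢ Zf := fun n x q hq => by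
    have h := mem_of_mem_chainPairs (hPmem n x) hq
    exact Finset.mem_product.2 ⟨(hmemZf _).2 (dyadicBlock_subset _ _ h.1),
      (hmemZf _).2 (dyadicBlock_subset _ _ h.2)⟩
  have hE : ∀ n (q : ℝ × ℝ), MeasurableSet {x | q ∈ P n x} := fun n q => by
    have : {x | q ∈ P n x} =
        ⋃ Q ∈ chainPairs (dyadicBlock Z n), {x | P n x = Q} ∩ {_x | q ∈ Q} := by
      ext x
      simp only [mem_ofPred_eq, mem_iUnion, mem_inter_iff, exists_prop]
      constructor
      · exact fun h => ⟨P n x, hPmem n x, rfl, h⟩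
      · rintro ⟨Q, -, rfl, h⟩; exact h
    rw [this]
    exact (finite_chainPairs (hZ.subset (dyadicBlock_subset Z n))).measurableSet_biUnion
      fun Q _ => (hPmeas n Q).inter (MeasurableSet.const _)
  -- the linearised operators
  set L : B × ↥(Zf ×ˢ Zf) → (X → ℂ) → (X → ℂ) := fun k f =>
    {x | k.2.1 ∈ P k.1 x}.indicator (T k.2.1.2 f - T k.2.1.1 f) with hL
  have hk : ∀ k : B × ↥(Zf ×ˢ Zf), k.2.1.1 ∈ Z ∧ k.2.1.2 ∈ Z := fun k => by
    have h := Finset.mem_product.1 k.2.2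
    exact ⟨(hmemZf _).1 h.1, (hmemZf _).1 h.2⟩
  have hLlin : ∀ k, IsLinearOnLp μ {ENNReal.ofReal s} (L k) := fun k => by
    have l1 := (hT _ (hk k).1).linear
    have l2 := (hT _ (hk k).2).linear
    refine ⟨?_, ?_, ?_, ?_⟩
    · rintro p rfl f hf
      exact ((l2.aestronglyMeasurable _ hpE f hf).sub
        (l1.aestronglyMeasurable _ hpE f hf)).indicator (hE _ _)
    · rintro p rfl f g' hf hfg
      filter_upwards [l1.congr_ae _ hpE f g' hf hfg, l2.congr_ae _ hpE f g' hf hfg] with x h1 h2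
      simp only [hL, indicator_apply, Pi.sub_apply, h1, h2]
    · rintro p rfl f g' hf hg'
      filter_upwards [l1.map_add _ hpE f g' hf hg', l2.map_add _ hpE f g' hf hg'] with x h1 h2
      simp only [hL, indicator_apply, Pi.sub_apply, Pi.add_apply, h1, h2]
      split_ifs
      · ring
      · simp
    · rintro p rfl c f hf
      filter_upwards [l1.map_smul _ hpE c f hf, l2.map_smul _ hpE c f hf] with x h1 h2
      simp only [hL, indicator_apply, Pi.sub_apply, Pi.smul_apply, h1, h2, smul_eq_mul]
      split_ifs
      · ring
      · simp
  have hsumL : ∀ (f : B → X → ℂ) (x : X) (r : ℝ), 0 < r →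
      ∑ k : B × ↥(Zf ×ˢ Zf), ‖L k (f k.1) x‖ₑ ^ r =
        ∑ n : B, ∑ q ∈ P n x, ‖T q.2 (f n) x - T q.1 (f n) x‖ₑ ^ r := fun f x r hr => by
    rw [Fintype.sum_prod_type]
    refine Finset.sum_congr rfl fun n _ => ?_
    have h1 : ∀ q : ↥(Zf ×ˢ Zf), ‖L (n, q) (f n) x‖ₑ ^ r =
        (if q.1 ∈ P n x then ‖T q.1.2 (f n) x - T q.1.1 (f n) x‖ₑ ^ r else 0) := fun q => by
      simp only [hL, indicator_apply, mem_ofPred_eq, Pi.sub_apply]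
      split_ifs <;> simp [hr]
    simp only [h1]
    rw [Finset.sum_coe_sort (Zf ×ˢ Zf) (fun q : ℝ × ℝ =>
      if q ∈ P n x then ‖T q.2 (f n) x - T q.1 (f n) x‖ₑ ^ r else 0), Finset.sum_ite_mem,
      Finset.inter_eq_right.2 (hPsub n x)]
  have hint := lintegral_sum_sq_le_of_interpolation (μ := μ) (fun k : B × ↥(Zf ×ˢ Zf) => k.1) L
    hs1 hs2 hLlin (C₃ + 4 * C₂) ?_ ?_ (fun n : B => g n) fun n => hg n
  · refine le_trans (lintegral_mono_ae ?_) (hint.trans ?_)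
    · have hall : ∀ᵐ x ∂μ, ∀ n ∈ B, ∀ t ∈ Zf, T t (g n) x = b n t x := by
        rw [Filter.eventually_all_finset]
        intro n _
        rw [Filter.eventually_all_finset]
        exact fun t ht => hbeq n t ((hmemZf t).1 ht)
      filter_upwards [hall] with x hx
      rw [ellTwo_eq_sum (s := B) fun n hn => by rw [hB n hn, rVariation_empty],
        ← ENNReal.rpow_mul, show (1 / 2 * s : ℝ) = s / 2 by ring]
      gcongr
      have := hsumL (fun n => g n) x 2 two_pos
      simp only [ENNReal.rpow_two] at this
      rw [this, Finset.sum_coe_sort B fun n : ℤ =>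
        ∑ q ∈ P n x, ‖T q.2 (g n) x - T q.1 (g n) x‖ₑ ^ 2]
      refine Finset.sum_le_sum fun n hn => ?_
      have hsum : ∀ Q ∈ chainPairs (dyadicBlock Z n),
          ∑ q ∈ Q, ‖T q.2 (g n) x - T q.1 (g n) x‖ₑ ^ (2 : ℝ) =
            ∑ q ∈ Q, ‖b n q.2 x - b n q.1 x‖ₑ ^ (2 : ℝ) := fun Q hQ =>
        Finset.sum_congr rfl fun q hq => by
          have h := mem_of_mem_chainPairs hQ hq
          rw [hx n hn q.1 ((hmemZf _).2 (dyadicBlock_subset _ _ h.1)),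
            hx n hn q.2 ((hmemZf _).2 (dyadicBlock_subset _ _ h.2))]
      rw [← ENNReal.rpow_two, ← ENNReal.le_rpow_inv_iff two_pos,
        rVariation_eq_iSup_chainPairs two_pos]
      refine iSup₂_le fun Q hQ => ?_
      rw [one_div]
      refine ENNReal.rpow_le_rpow ?_ (by norm_num)
      simp only [← ENNReal.rpow_two]
      rw [hsum Q hQ, hsum _ (hPmem n x)]
      exact hPmax n x Q hQ
    · push_cast
      gcongr with x
      rw [ellTwo, ← ENNReal.rpow_mul, show (1 / 2 * s : ℝ) = s / 2 by ring]
      gcongr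
      rw [Finset.sum_coe_sort B fun n : ℤ => ‖g n x‖ₑ ^ 2]
      exact ENNReal.sum_le_tsum B
  -- the endpoint `ℓ^s`
  · intro f hf
    calc ∫⁻ x, ∑ k : B × ↥(Zf ×ˢ Zf), ‖L k (f k.1) x‖ₑ ^ s ∂μ
        ≤ ∫⁻ x, ∑ n : B, rVariation s (fun t => T t (f n) x) (dyadicBlock Z n) ^ s ∂μ := by
          refine lintegral_mono fun x => ?_
          rw [hsumL f x s hs0]
          refine Finset.sum_le_sum fun n _ => ?_
          rw [← ENNReal.rpow_inv_le_iff hs0, rVariation_eq_iSup_chainPairs hs0, ← one_div]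
          exact le_iSup₂_of_le _ (hPmem n x) le_rfl
      _ = ∑ n : B, ∫⁻ x, rVariation s (fun t => T t (f n) x) (dyadicBlock Z n) ^ s ∂μ :=
          lintegral_finsetSum' _ fun n _ => (aemeasurable_rVariation hs0
            (hZ.subset (dyadicBlock_subset Z n)) fun t ht =>
              hmeas _ (hf n) t (dyadicBlock_subset Z n ht)).pow_const _
      _ ≤ ∑ n : B, (C₃ : ℝ≥0∞) ^ s * ∫⁻ x, ‖f n x‖ₑ ^ s ∂μ :=
          Finset.sum_le_sum fun n _ => hvar n _ (hf n)
      _ = (C₃ : ℝ≥0∞) ^ s * ∫⁻ x, ∑ n : B, ‖f n x‖ₑ ^ s ∂μ := by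
          rw [lintegral_finsetSum' _ fun n _ => (hf n).1.aemeasurable.enorm.pow_const _,
            Finset.mul_sum]
      _ ≤ _ := by
          gcongr
          exact le_self_add
  -- the endpoint `ℓ^∞`
  · intro f G hf hG hfG
    have hGc : MemLp (fun x => (G x : ℂ)) (ENNReal.ofReal s) μ := hG.ofReal
    have hdom : ∀ᵐ x ∂μ, ∀ n : B, ∀ t ∈ Zf,
        ‖T t (f n) x‖ₑ ≤ 2 * ‖T t (fun x => (G x : ℂ)) x‖ₑ := by
      rw [ae_all_iff]
      intro n
      rw [Filter.eventually_all_finset]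
      exact fun t ht => (hT t ((hmemZf t).1 ht)).enorm_le hpE.1 (hf n) hG (hfG n)
    calc ∫⁻ x, (⨆ k : B × ↥(Zf ×ˢ Zf), ‖L k (f k.1) x‖ₑ) ^ s ∂μ
        ≤ ∫⁻ x, (4 : ℝ≥0∞) ^ s * (⨆ t ∈ Z, ‖T t (fun x => (G x : ℂ)) x‖ₑ) ^ s ∂μ := by
          refine lintegral_mono_ae ?_
          filter_upwards [hdom] with x hx
          rw [← ENNReal.mul_rpow_of_nonneg _ _ hs0.le]
          gcongr
          refine iSup_le fun k => ?_
          have h1 : ∀ t ∈ Z, ‖T t (f k.1) x‖ₑ ≤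
              2 * ⨆ t ∈ Z, ‖T t (fun x => (G x : ℂ)) x‖ₑ := fun t ht =>
            (hx k.1 t ((hmemZf t).2 ht)).trans (by
              gcongr
              exact le_iSup₂_of_le (f := fun t (_ : t ∈ Z) => ‖T t (fun x => (G x : ℂ)) x‖ₑ)
                t ht le_rfl)
          calc ‖L k (f k.1) x‖ₑ ≤ ‖T k.2.1.2 (f k.1) x - T k.2.1.1 (f k.1) x‖ₑ :=
                enorm_indicator_le_enorm_self _ _
            _ ≤ ‖T k.2.1.2 (f k.1) x‖ₑ + ‖T k.2.1.1 (f k.1) x‖ₑ := enorm_sub_le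
            _ ≤ 2 * (⨆ t ∈ Z, ‖T t (fun x => (G x : ℂ)) x‖ₑ) +
                2 * (⨆ t ∈ Z, ‖T t (fun x => (G x : ℂ)) x‖ₑ) :=
                add_le_add (h1 _ (hk k).2) (h1 _ (hk k).1)
            _ = _ := by ring
      _ = (4 : ℝ≥0∞) ^ s * ∫⁻ x, (⨆ t ∈ Z, ‖T t (fun x => (G x : ℂ)) x‖ₑ) ^ s ∂μ :=
          lintegral_const_mul' _ _ (ENNReal.rpow_lt_top_of_nonneg hs0.le (by norm_num)).ne
      _ ≤ (4 : ℝ≥0∞) ^ s * ((C₂ : ℝ≥0∞) ^ s * ∫⁻ x, ‖(G x : ℂ)‖ₑ ^ s ∂μ) := by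
          gcongr
          exact hmax _ hGc
      _ = (4 * C₂ : ℝ≥0∞) ^ s * ∫⁻ x, ‖G x‖ₑ ^ s ∂μ := by
          rw [← mul_assoc, ← ENNReal.mul_rpow_of_nonneg _ _ hs0.le]
          simp only [← ofReal_norm, Complex.norm_real]
      _ ≤ _ := by
          gcongr
          push_cast
          exact le_add_self

/-! ### Finite parameter sets -/

/-- The hypotheses of the theorem for a finite parameter set `Z`, where continuity in the parameter
plays no role. All of them are inherited by subsets of the parameter set. -/
structure ShortVariationHypotheses {X : Type*} [MeasurableSpace X] (μ : Measure X) (p₀ : ℝ)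
    (C₁ C₂ C₃ : ℝ → ℝ≥0) (C₄ : ℝ≥0) (a : ℤ → ℝ≥0) (Z : Set ℝ)
    (T : ℝ → (X → ℂ) → (X → ℂ)) (S : ℤ → (X → ℂ) → (X → ℂ)) : Prop where
  finite : Z.Finite
  pos : Z ⊆ Ioi 0
  positive : ∀ t ∈ Z, IsPositiveLinearOperator μ (T t)
  linear : ∀ n, IsLinearOnLp μ (Set.Ioc 1 2) (S n)
  tendsto : ∀ f : X → ℂ, MemLp f 2 μ → Tendsto (fun N : ℕ =>
    eLpNorm (fun x => f x - ∑ n ∈ Finset.Icc (-(N : ℤ)) N, S n f x) 2 μ) atTop (𝓝 0)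
  square : ∀ q ∈ Set.Ioc (1 : ℝ) 2, ∀ f : X → ℂ, MemLp f (ENNReal.ofReal q) μ →
    eLpNorm (fun x => ellTwo fun n => ‖S n f x‖ₑ) (ENNReal.ofReal q) μ
      ≤ C₁ q * eLpNorm f (ENNReal.ofReal q) μ
  maximal : ∀ q ∈ Set.Ioc p₀ 2, ∀ f : X → ℂ, MemLp f (ENNReal.ofReal q) μ →
    eLpNorm (fun x => ⨆ t ∈ Z, ‖T t f x‖ₑ) (ENNReal.ofReal q) μ
      ≤ C₂ q * eLpNorm f (ENNReal.ofReal q) μ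
  variation : ∀ q ∈ Set.Ioc p₀ 2, ∀ f : X → ℂ, MemLp f (ENNReal.ofReal q) μ →
    ∀ n : ℤ, eLpNorm (fun x => rVariation q (fun t => T t f x) (dyadicBlock Z n))
      (ENNReal.ofReal q) μ ≤ C₃ q * eLpNorm f (ENNReal.ofReal q) μ
  decay : ∀ j : ℤ, ∀ f : X → ℂ, MemLp f 2 μ →
    eLpNorm (fun x => ellTwo fun n =>
      rVariation 2 (fun t => T t (S (j + n) f) x) (dyadicBlock Z n)) 2 μ
      ≤ C₄ * a j * eLpNorm f 2 μ

/-- A crude bound for all variations on a finite parameter set, whose constant depends on it. -/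
theorem exists_ellTwo_rVariation_le_iSup {Z : Set ℝ} (hZ : Z.Finite) (hpos : Z ⊆ Ioi 0) :
    ∃ K : ℝ≥0, 0 < K ∧ ∀ c : ℝ → ℂ, ellTwo (fun n => rVariation 2 c (dyadicBlock Z n)) ≤
      K * ⨆ t ∈ Z, ‖c t‖ₑ := by
  obtain ⟨B, hB⟩ := exists_finset_dyadicBlock_eq_empty hZ hpos
  refine ⟨(B.card * ((hZ.toFinset ×ˢ hZ.toFinset).card * 2) : ℕ) + 1, by positivity, fun c => ?_⟩
  refine (ellTwo_le_sum (s := B) fun n hn => by rw [hB n hn, rVariation_empty]).trans ?_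
  have h1 : ∀ t ∈ Z, ‖c t‖ₑ ≤ ⨆ t ∈ Z, ‖c t‖ₑ := fun t ht =>
    le_iSup₂_of_le (f := fun t (_ : t ∈ Z) => ‖c t‖ₑ) t ht le_rfl
  have h2 : ∀ n ∈ B, rVariation 2 c (dyadicBlock Z n) ≤
      (hZ.toFinset ×ˢ hZ.toFinset).card • (2 * ⨆ t ∈ Z, ‖c t‖ₑ) := fun n _ => by
    refine ((rVariation_mono 2 c (dyadicBlock_subset Z n)).trans ?_).trans
      (Finset.sum_le_card_nsmul _ (fun q : ℝ × ℝ => ‖c q.2‖ₑ + ‖c q.1‖ₑ) _ fun q hq => ?_)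
    · simpa using rVariation_le_sum (r := 2) (by norm_num) c hZ.toFinset
    · rw [Finset.mem_product, hZ.mem_toFinset, hZ.mem_toFinset] at hq
      rw [two_mul]
      exact add_le_add (h1 _ hq.2) (h1 _ hq.1)
  refine ((Finset.sum_le_card_nsmul B _ _ h2).trans_eq ?_).trans
    (mul_le_mul_left (ENNReal.coe_le_coe.2 le_self_add) _)
  simp only [nsmul_eq_mul]
  push_cast
  ring

/-- The large values of an `L^p` function lie in `L^s` for `s ≤ p`. -/
theorem MeasureTheory.MemLp.indicator_lt_norm {X : Type*} [MeasurableSpace X] {μ : Measure X}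
    {f : X → ℂ} {s p l : ℝ} (hs : 0 < s) (hsp : s ≤ p) (hl : 0 < l)
    (hf : MemLp f (ENNReal.ofReal p) μ) :
    MemLp ({x | l < ‖f x‖}.indicator f) (ENNReal.ofReal s) μ := by
  have hp : 0 < p := hs.trans_le hsp
  refine ⟨hf.1.indicator₀ (nullMeasurableSet_lt aemeasurable_const hf.1.norm.aemeasurable), ?_⟩
  have h := (eLpNorm_lt_top_iff_lintegral_rpow_enorm_lt_top (by simpa using hp)
    ENNReal.ofReal_ne_top).1 hf.2
  rw [ENNReal.toReal_ofReal hp.le] at h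
  rw [eLpNorm_lt_top_iff_lintegral_rpow_enorm_lt_top (by simpa using hs) ENNReal.ofReal_ne_top,
    ENNReal.toReal_ofReal hs.le]
  refine lt_of_le_of_lt (lintegral_mono (g := fun x => ENNReal.ofReal (l ^ (s - p)) * ‖f x‖ₑ ^ p)
    fun x => ?_) ?_
  · rw [indicator_apply]
    split_ifs with hx
    · have hx : l < ‖f x‖ := hx
      change ‖f x‖ₑ ^ s ≤ ENNReal.ofReal (l ^ (s - p)) * ‖f x‖ₑ ^ p
      rw [← ofReal_norm, ENNReal.ofReal_rpow_of_nonneg (norm_nonneg _) hs.le,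
        ENNReal.ofReal_rpow_of_nonneg (norm_nonneg _) hp.le, ← ENNReal.ofReal_mul (by positivity)]
      refine ENNReal.ofReal_le_ofReal ?_
      calc ‖f x‖ ^ s = ‖f x‖ ^ (s - p) * ‖f x‖ ^ p := by
            rw [← Real.rpow_add (hl.trans hx)]; congr 1; ring
        _ ≤ _ := by
            refine mul_le_mul_of_nonneg_right ?_ (by positivity)
            exact Real.rpow_le_rpow_of_nonpos hl hx.le (by linarith)
    · simp [hs]
  · rw [lintegral_const_mul' _ _ ENNReal.ofReal_ne_top]
    exact ENNReal.mul_lt_top ENNReal.ofReal_lt_top h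

/-- The small values of an `L^p` function lie in `L^s` for `s ≥ p`. -/
theorem MeasureTheory.MemLp.indicator_norm_le {X : Type*} [MeasurableSpace X] {μ : Measure X}
    {f : X → ℂ} {s p l : ℝ} (hp : 0 < p) (hsp : p ≤ s) (hf : MemLp f (ENNReal.ofReal p) μ) :
    MemLp ({x | ‖f x‖ ≤ l}.indicator f) (ENNReal.ofReal s) μ := by
  have hs : 0 < s := hp.trans_le hsp
  refine ⟨hf.1.indicator₀ (nullMeasurableSet_le hf.1.norm.aemeasurable aemeasurable_const), ?_⟩
  have h := (eLpNorm_lt_top_iff_lintegral_rpow_enorm_lt_top (by simpa using hp)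
    ENNReal.ofReal_ne_top).1 hf.2
  rw [ENNReal.toReal_ofReal hp.le] at h
  rw [eLpNorm_lt_top_iff_lintegral_rpow_enorm_lt_top (by simpa using hs) ENNReal.ofReal_ne_top,
    ENNReal.toReal_ofReal hs.le]
  refine lt_of_le_of_lt (lintegral_mono (g := fun x => ENNReal.ofReal (l ^ (s - p)) * ‖f x‖ₑ ^ p)
    fun x => ?_) ?_
  · rw [indicator_apply]
    split_ifs with hx
    · have hx : ‖f x‖ ≤ l := hx
      have hl : 0 ≤ l := (norm_nonneg _).trans hx
      change ‖f x‖ₑ ^ s ≤ ENNReal.ofReal (l ^ (s - p)) * ‖f x‖ₑ ^ p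
      rw [← ofReal_norm, ENNReal.ofReal_rpow_of_nonneg (norm_nonneg _) hs.le,
        ENNReal.ofReal_rpow_of_nonneg (norm_nonneg _) hp.le, ← ENNReal.ofReal_mul (by positivity)]
      refine ENNReal.ofReal_le_ofReal ?_
      calc ‖f x‖ ^ s = ‖f x‖ ^ (s - p) * ‖f x‖ ^ p := by
            rw [← Real.rpow_add_of_nonneg (norm_nonneg _) (by linarith) hp.le]; congr 1; ring
        _ ≤ _ := by
            refine mul_le_mul_of_nonneg_right ?_ (by positivity)
            exact Real.rpow_le_rpow (norm_nonneg _) hx (by linarith)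
    · simp [hs]
  · rw [lintegral_const_mul' _ _ ENNReal.ofReal_ne_top]
    exact ENNReal.mul_lt_top ENNReal.ofReal_lt_top h

namespace ShortVariationHypotheses

variable {X : Type*} [MeasurableSpace X] {μ : Measure X} {p₀ : ℝ} {C₁ C₂ C₃ : ℝ → ℝ≥0} {C₄ : ℝ≥0}
  {a : ℤ → ℝ≥0} {Z : Set ℝ} {T : ℝ → (X → ℂ) → (X → ℂ)} {S : ℤ → (X → ℂ) → (X → ℂ)}

theorem memLp_S (H : ShortVariationHypotheses μ p₀ C₁ C₂ C₃ C₄ a Z T S) {q : ℝ}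
    (hq : q ∈ Set.Ioc (1 : ℝ) 2) {f : X → ℂ} (hf : MemLp f (ENNReal.ofReal q) μ) (n : ℤ) :
    MemLp (S n f) (ENNReal.ofReal q) μ := by
  have hqI : ENNReal.ofReal q ∈ Set.Ioc (1 : ℝ≥0∞) 2 :=
    ⟨by simpa using hq.1, by simpa using ENNReal.ofReal_le_ofReal hq.2⟩
  refine ⟨(H.linear n).aestronglyMeasurable _ hqI f hf, ?_⟩
  refine lt_of_le_of_lt ?_ ((H.square q hq f hf).trans_lt
    (ENNReal.mul_lt_top ENNReal.coe_lt_top hf.2))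
  refine eLpNorm_mono_enorm fun x => ?_
  rw [enorm_eq_self, ellTwo, ← ENNReal.rpow_inv_le_iff (by norm_num)]
  simp only [one_div, inv_inv, ENNReal.rpow_two]
  exact ENNReal.le_tsum n

theorem aemeasurable_T (H : ShortVariationHypotheses μ p₀ C₁ C₂ C₃ C₄ a Z T S) {q : ℝ}
    (hq : 1 ≤ q) {f : X → ℂ} (hf : MemLp f (ENNReal.ofReal q) μ) {t : ℝ} (ht : t ∈ Z) :
    AEMeasurable (T t f) μ :=
  ((H.positive t ht).linear.aestronglyMeasurable _ ⟨by simpa using hq, le_top⟩ f hf).aemeasurable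

theorem aemeasurable_ellTwo_rVariation (H : ShortVariationHypotheses μ p₀ C₁ C₂ C₃ C₄ a Z T S)
    {q : ℝ} (hq : 1 ≤ q) {g : ℤ → X → ℂ} (hg : ∀ n, MemLp (g n) (ENNReal.ofReal q) μ) :
    AEMeasurable (fun x => ellTwo fun n =>
      rVariation 2 (fun t => T t (g n) x) (dyadicBlock Z n)) μ :=
  AEMeasurable.ellTwo fun n => aemeasurable_rVariation two_pos
    (H.finite.subset (dyadicBlock_subset Z n)) fun _ ht =>
      H.aemeasurable_T hq (hg n) (dyadicBlock_subset Z n ht)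

/-- Subadditivity of the square function of the variations. -/
theorem ellTwo_rVariation_add_le (H : ShortVariationHypotheses μ p₀ C₁ C₂ C₃ C₄ a Z T S)
    {q : ℝ} (hq : 1 ≤ q) {f g h : ℤ → X → ℂ} (hg : ∀ n, MemLp (g n) (ENNReal.ofReal q) μ)
    (hh : ∀ n, MemLp (h n) (ENNReal.ofReal q) μ) (hfgh : ∀ n, f n =ᵐ[μ] g n + h n) :
    ∀ᵐ x ∂μ, ellTwo (fun n => rVariation 2 (fun t => T t (f n) x) (dyadicBlock Z n)) ≤
      ellTwo (fun n => rVariation 2 (fun t => T t (g n) x) (dyadicBlock Z n)) +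
      ellTwo (fun n => rVariation 2 (fun t => T t (h n) x) (dyadicBlock Z n)) := by
  have hqI : ENNReal.ofReal q ∈ Set.Icc (1 : ℝ≥0∞) ⊤ := ⟨by simpa using hq, le_top⟩
  have hall : ∀ᵐ x ∂μ, ∀ n, ∀ t ∈ Z, T t (f n) x = T t (g n) x + T t (h n) x := by
    rw [ae_all_iff]
    intro n
    rw [ae_ball_iff H.finite.countable]
    intro t ht
    have hl := (H.positive t ht).linear
    filter_upwards [hl.map_add _ hqI _ _ (hg n) (hh n), hl.congr_ae _ hqI _ _
      ((memLp_congr_ae (hfgh n)).2 ((hg n).add (hh n))) (hfgh n)] with x h1 h2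
    rw [h2, h1, Pi.add_apply]
  filter_upwards [hall] with x hx
  refine (ellTwo_mono fun n => ?_).trans (ellTwo_add_le _ _)
  rw [rVariation_congr fun t ht => hx n t (dyadicBlock_subset Z n ht)]
  exact rVariation_add_le (by norm_num) _ _ _

/-- The frequency-localised pieces are bounded on `L^s`, uniformly in the frequency shift. -/
theorem lintegral_shift_le (H : ShortVariationHypotheses μ p₀ C₁ C₂ C₃ C₄ a Z T S)
    (hp₀ : 1 ≤ p₀) {s : ℝ} (hs : s ∈ Set.Ioc p₀ 2) (j : ℤ) {f : X → ℂ}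
    (hf : MemLp f (ENNReal.ofReal s) μ) :
    ∫⁻ x, ellTwo (fun n => rVariation 2 (fun t => T t (S (j + n) f) x) (dyadicBlock Z n)) ^ s ∂μ ≤
      ((4 * (C₃ s + 4 * C₂ s) * C₁ s : ℝ≥0) : ℝ≥0∞) ^ s * ∫⁻ x, ‖f x‖ₑ ^ s ∂μ := by
  have hs1 : 1 < s := hp₀.trans_lt hs.1
  have hs0 : 0 < s := by linarith
  have h := lintegral_ellTwo_rVariation_le hs1 hs.2 H.finite H.pos H.positive
    (fun f hf => by
      simpa using (eLpNorm_le_mul_eLpNorm_iff hs0 _ _ _).1 (H.maximal s hs f hf))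
    (fun n f hf => by
      simpa using (eLpNorm_le_mul_eLpNorm_iff hs0 _ _ _).1 (H.variation s hs f hf n))
    (fun n => S (j + n) f) fun n => H.memLp_S ⟨hs1, hs.2⟩ hf _
  refine h.trans ?_
  simp only [fun x => ellTwo_comp_add_left (fun n => ‖S n f x‖ₑ) j]
  have h2 := (eLpNorm_le_mul_eLpNorm_iff hs0 _ _ _).1 (H.square s ⟨hs1, hs.2⟩ f hf)
  simp only [enorm_eq_self] at h2
  refine (mul_le_mul_right h2 _).trans_eq ?_
  rw [← mul_assoc, ← ENNReal.mul_rpow_of_nonneg _ _ hs0.le]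
  push_cast
  ring_nf

end ShortVariationHypotheses

namespace ShortVariationHypotheses

variable {X : Type*} [MeasurableSpace X] {μ : Measure X} {p₀ : ℝ} {C₁ C₂ C₃ : ℝ → ℝ≥0} {C₄ : ℝ≥0}
  {a : ℤ → ℝ≥0} {Z : Set ℝ} {T : ℝ → (X → ℂ) → (X → ℂ)} {S : ℤ → (X → ℂ) → (X → ℂ)}

/-- Interpolation of the uniform bound on `L^s` with the decaying bound on `L^2`. -/
theorem lintegral_shift_le_of_lt_two [SigmaFinite μ]
    (H : ShortVariationHypotheses μ p₀ C₁ C₂ C₃ C₄ a Z T S)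
    (hp₀ : 1 ≤ p₀) {s p : ℝ} (hs : p₀ < s) (hsp : s < p) (hp : p < 2) (j : ℤ) (ha : 0 < a j)
    {f : X → ℂ} (hf : MemLp f (ENNReal.ofReal p) μ) :
    ∫⁻ x, ellTwo (fun n => rVariation 2 (fun t => T t (S (j + n) f) x) (dyadicBlock Z n)) ^ p ∂μ ≤
      ENNReal.ofReal (2 ^ p * p) *
        (((4 * (C₃ s + 4 * C₂ s) * C₁ s : ℝ≥0) : ℝ≥0∞) ^ s *
          ENNReal.ofReal (((C₄ + 1) * a j : ℝ) ^ (p - s) / (p - s)) +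
        ENNReal.ofReal (((C₄ + 1) * a j : ℝ) ^ p / (2 - p))) * ∫⁻ x, ‖f x‖ₑ ^ p ∂μ := by
  have hs1 : 1 < s := hp₀.trans_lt hs
  have hs0 : 0 < s := by linarith
  have hp1 : 1 < p := hs1.trans hsp
  have hpI : p ∈ Set.Ioc (1 : ℝ) 2 := ⟨hp1, hp.le⟩
  have hp1' : (1 : ℝ≥0∞) < ENNReal.ofReal p := by simpa using hp1
  have hpS : ENNReal.ofReal p ∈ Set.Ioc (1 : ℝ≥0∞) 2 :=
    ⟨hp1', by simpa using ENNReal.ofReal_le_ofReal hp.le⟩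
  have h2 : ENNReal.ofReal 2 = 2 := by simp
  have hmemS : ∀ g : X → ℂ, MemLp g (ENNReal.ofReal p) μ → ∀ n,
      MemLp (S (j + n) g) (ENNReal.ofReal p) μ := fun g hg n => H.memLp_S hpI hg _
  refine lintegral_rpow_le_of_truncation hs0 hsp hp (b := (C₄ + 1) * a j) (by positivity)
    (H.aemeasurable_ellTwo_rVariation hp1.le (hmemS f hf)) (fun x => ?_) hf.1.aemeasurable ?_
  · obtain ⟨B, hB⟩ := exists_finset_dyadicBlock_eq_empty H.finite H.pos
    refine ((ellTwo_le_sum (s := B) fun n hn => by rw [hB n hn, rVariation_empty]).trans_lt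
      (ENNReal.sum_lt_top.2 fun n _ => ?_)).ne
    refine lt_of_le_of_lt ?_ (ENNReal.sum_lt_top.2 fun q (_ : q ∈ H.finite.toFinset ×ˢ
      H.finite.toFinset) => ENNReal.add_lt_top.2
        ⟨enorm_lt_top (x := T q.2 (S (j + n) f) x), enorm_lt_top (x := T q.1 (S (j + n) f) x)⟩)
    refine (rVariation_mono 2 _ (dyadicBlock_subset Z n)).trans ?_
    simpa using rVariation_le_sum (r := 2) (by norm_num) (fun t => T t (S (j + n) f) x)
      H.finite.toFinset
  intro l hl
  set f₁ : X → ℂ := {x | l < ‖f x‖}.indicator f with hf₁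
  set f₂ : X → ℂ := {x | ‖f x‖ ≤ l}.indicator f with hf₂
  have m1 : MemLp f₁ (ENNReal.ofReal p) μ := hf.indicator_lt_norm (by linarith) le_rfl hl
  have m1s : MemLp f₁ (ENNReal.ofReal s) μ := hf.indicator_lt_norm hs0 hsp.le hl
  have m2 : MemLp f₂ (ENNReal.ofReal p) μ := hf.indicator_norm_le (by linarith) le_rfl
  have m22 : MemLp f₂ (ENNReal.ofReal 2) μ := hf.indicator_norm_le (by linarith) hp.le
  have hsum : f = f₁ + f₂ := by
    ext x
    simp only [hf₁, hf₂, Pi.add_apply, indicator_apply, mem_ofPred_eq]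
    by_cases h : l < ‖f x‖
    · simp [h, not_le.2 h]
    · simp [h, not_lt.1 h]
  refine ⟨_, _, H.aemeasurable_ellTwo_rVariation hp1.le (hmemS f₁ m1),
    H.aemeasurable_ellTwo_rVariation hp1.le (hmemS f₂ m2),
    H.ellTwo_rVariation_add_le hp1.le (hmemS f₁ m1) (hmemS f₂ m2) fun n => ?_,
    H.lintegral_shift_le hp₀ ⟨hs, by linarith⟩ j m1s, ?_⟩
  · have := (H.linear (j + n)).map_add _ hpS f₁ f₂ m1 m2
    rwa [← hsum] at this
  · have hd := H.decay j f₂ (by rwa [h2] at m22)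
    rw [← h2, ← ENNReal.coe_mul] at hd
    have hd' := (eLpNorm_le_mul_eLpNorm_iff two_pos _ _ _).1 hd
    simp only [enorm_eq_self] at hd'
    refine hd'.trans ?_
    gcongr
    rw [ENNReal.rpow_two, ENNReal.ofReal_pow (by positivity)]
    gcongr
    rw [ENNReal.ofReal, Real.toNNReal_mul (by positivity)]
    gcongr
    · rw [← NNReal.coe_le_coe, Real.coe_toNNReal _ (by positivity)]; simp
    · simp

/-- The tail of the frequency decomposition is negligible: the variations of `T t f` are dominated
by those of all frequency pieces. -/
theorem ellTwo_rVariation_le_tsum (H : ShortVariationHypotheses μ p₀ C₁ C₂ C₃ C₄ a Z T S)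
    (hp₀ : p₀ ∈ Set.Ico (1 : ℝ) 2) {f : X → ℂ} (hf : MemLp f 2 μ) :
    ∀ᵐ x ∂μ, ellTwo (fun n => rVariation 2 (fun t => T t f x) (dyadicBlock Z n)) ≤
      ∑' j : ℤ, ellTwo fun n =>
        rVariation 2 (fun t => T t (S (j + n) f) x) (dyadicBlock Z n) := by
  classical
  have h2 : ENNReal.ofReal 2 = 2 := by simp
  have h2I : (2 : ℝ≥0∞) ∈ Set.Icc (1 : ℝ≥0∞) ⊤ := ⟨by norm_num, le_top⟩
  have hSm : ∀ n, MemLp (S n f) 2 μ := fun n => by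
    have := H.memLp_S (q := 2) ⟨one_lt_two, le_rfl⟩ (f := f) (by rwa [h2]) n
    rwa [h2] at this
  set r : ℕ → X → ℂ := fun N x => f x - ∑ n ∈ Finset.Icc (-(N : ℤ)) N, S n f x with hr
  have hrm : ∀ N, MemLp (r N) 2 μ := fun N => hf.sub (memLp_finsetSum _ fun n _ => hSm n)
  set h : ℕ → X → ℝ≥0∞ := fun N x => ⨆ t ∈ Z, ‖T t (r N) x‖ₑ
  -- only the infimum over `N` is needed, and it vanishes because its `L^2` norm is at most that
  -- of every `h N`
  have hinf : ∀ᵐ x ∂μ, ⨅ N, h N x = 0 := by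
    have hle : ∀ N, eLpNorm (fun x => ⨅ N, h N x) 2 μ ≤ C₂ 2 * eLpNorm (r N) 2 μ := fun N => by
      have := H.maximal 2 ⟨hp₀.2, le_rfl⟩ (r N) (by rw [h2]; exact hrm N)
      rw [h2] at this
      refine le_trans (eLpNorm_mono_enorm fun x => ?_) this
      rw [enorm_eq_self, enorm_eq_self]
      exact iInf_le _ N
    have hlim : Tendsto (fun N => C₂ 2 * eLpNorm (r N) 2 μ) atTop (𝓝 0) := by
      have := ENNReal.Tendsto.const_mul (a := (C₂ 2 : ℝ≥0∞)) (H.tendsto f hf)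
        (Or.inr ENNReal.coe_ne_top)
      simpa using this
    have h0 : eLpNorm (fun x => ⨅ N, h N x) 2 μ = 0 :=
      le_antisymm (ge_of_tendsto' hlim hle) zero_le
    have hmeas : AEMeasurable (fun x => ⨅ N, h N x) μ := by
      refine AEMeasurable.iInf fun N => AEMeasurable.biSup _ H.finite.countable fun t ht => ?_
      exact (H.aemeasurable_T (q := 2) one_le_two (by rw [h2]; exact hrm N) ht).enorm
    exact (eLpNorm_eq_zero_iff hmeas.aestronglyMeasurable two_ne_zero).1 h0
  have hdec : ∀ᵐ x ∂μ, ∀ N : ℕ, ∀ t ∈ Z,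
      T t f x = ∑ n ∈ Finset.Icc (-(N : ℤ)) N, T t (S n f) x + T t (r N) x := by
    rw [ae_all_iff]
    intro N
    rw [ae_ball_iff H.finite.countable]
    intro t ht
    have hl := (H.positive t ht).linear
    have e1 : f = (∑ n ∈ Finset.Icc (-(N : ℤ)) N, (1 : ℂ) • S n f) + r N := by
      ext x
      simp [hr, Finset.sum_apply]
    have e2 := hl.map_add 2 h2I _ _ (memLp_finsetSum' (Finset.Icc (-(N : ℤ)) N)
      fun n _ => (hSm n).const_smul (1 : ℂ)) (hrm N)
    rw [← e1] at e2
    filter_upwards [e2, hl.map_sum_smul h2I (Finset.Icc (-(N : ℤ)) N) (fun _ => (1 : ℂ))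
      (fun n => S n f) fun n _ => hSm n] with x h1 h3
    rw [h1, Pi.add_apply, h3]
    simp [Finset.sum_apply]
  obtain ⟨B, hB⟩ := exists_finset_dyadicBlock_eq_empty H.finite H.pos
  obtain ⟨K, hK0, hK⟩ := exists_ellTwo_rVariation_le_iSup H.finite H.pos
  filter_upwards [hinf, hdec] with x hx0 hx
  set V : ℤ → ℤ → ℝ≥0∞ := fun m n => rVariation 2 (fun t => T t (S m f) x) (dyadicBlock Z n)
  have hN : ∀ N : ℕ, ellTwo (fun n => rVariation 2 (fun t => T t f x) (dyadicBlock Z n)) ≤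
      ∑' j : ℤ, ellTwo (fun n => V (j + n) n) + K * h N x := fun N => by
    set I : Finset ℤ := Finset.Icc (-(N : ℤ)) N
    set J : Finset ℤ := Finset.image₂ (fun m n => m - n) I B
    have h1 : ∀ n, rVariation 2 (fun t => T t f x) (dyadicBlock Z n) ≤
        ∑ j ∈ J, V (j + n) n + rVariation 2 (fun t => T t (r N) x) (dyadicBlock Z n) := fun n => by
      by_cases hn : n ∈ B
      · rw [rVariation_congr fun t ht => hx N t (dyadicBlock_subset Z n ht)]
        refine (rVariation_add_le one_le_two _ _ _).trans ?_
        gcongr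
        refine (rVariation_sum_le one_le_two I (fun m t => T t (S m f) x) _).trans ?_
        calc ∑ m ∈ I, V m n = ∑ j ∈ I.image (fun m => m - n), V (j + n) n := by
              rw [Finset.sum_image fun _ _ _ _ h => sub_left_injective h]
              simp
          _ ≤ _ := Finset.sum_le_sum_of_subset (Finset.image_subset_image₂_left hn)
      · rw [hB n hn, rVariation_empty]; exact zero_le
    refine (ellTwo_mono h1).trans ((ellTwo_add_le _ _).trans (add_le_add ?_ (hK _)))
    exact (ellTwo_sum_le J fun j n => V (j + n) n).trans (ENNReal.sum_le_tsum J)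
  calc _ ≤ ⨅ N, (∑' j : ℤ, ellTwo (fun n => V (j + n) n) + K * h N x) := le_iInf hN
    _ = ∑' j : ℤ, ellTwo (fun n => V (j + n) n) + K * ⨅ N, h N x := by
      rw [← ENNReal.add_iInf, ENNReal.mul_iInf_of_ne (by exact_mod_cast hK0.ne')
        ENNReal.coe_ne_top]
    _ = _ := by rw [hx0, mul_zero, add_zero]

end ShortVariationHypotheses

/-- The bounds of the frequency-localised pieces are summable over the frequency shift. -/
theorem exists_summable_shift_bound (p₀ : ℝ) (hp₀ : p₀ ∈ Set.Ico (1 : ℝ) 2)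
    (C₁ C₂ C₃ : ℝ → ℝ≥0) (C₄ : ℝ≥0) (a : ℤ → ℝ≥0) (ha : ∀ j, 0 < a j)
    (ha_sum : ∀ ρ : ℝ, 0 < ρ → Summable fun j => a j ^ ρ) (p : ℝ) (hp : p ∈ Set.Ioc p₀ 2) :
    ∃ D : ℤ → ℝ≥0, Summable D ∧ ∀ (X : Type*) [MeasurableSpace X] (μ : Measure X) [SigmaFinite μ]
      (Z : Set ℝ) (T : ℝ → (X → ℂ) → (X → ℂ)) (S : ℤ → (X → ℂ) → (X → ℂ)),
      ShortVariationHypotheses μ p₀ C₁ C₂ C₃ C₄ a Z T S → ∀ (j : ℤ) (f : X → ℂ),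
      MemLp f (ENNReal.ofReal p) μ →
      eLpNorm (fun x => ellTwo fun n =>
        rVariation 2 (fun t => T t (S (j + n) f) x) (dyadicBlock Z n)) (ENNReal.ofReal p) μ ≤
        D j * eLpNorm f (ENNReal.ofReal p) μ := by
  have hp1 : 1 < p := hp₀.1.trans_lt hp.1
  have hp0 : 0 < p := by linarith
  rcases hp.2.eq_or_lt with rfl | hp2
  · refine ⟨fun j => C₄ * a j, ?_, ?_⟩
    · have := ha_sum 1 one_pos
      simp only [NNReal.rpow_one] at this
      exact this.mul_left C₄
    · intro X _ μ _ Z T S H j f hf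
      have h2 : ENNReal.ofReal 2 = 2 := by simp
      rw [h2] at hf ⊢
      push_cast
      exact H.decay j f hf
  -- an exponent strictly between `p₀` and `p` serves as the endpoint without decay
  obtain ⟨s, hs, hsp⟩ := exists_between hp.1
  have hps : 0 < p - s := by linarith
  have hp2' : 0 < 2 - p := by linarith
  set A : ℝ≥0 := (4 * (C₃ s + 4 * C₂ s) * C₁ s) ^ s
  set M : ℝ≥0 := (2 ^ p * p).toNNReal
  set b : ℤ → ℝ≥0 := fun j => (C₄ + 1) * a j with hb
  set M₁ : ℝ≥0 := M * (A * (1 / (p - s)).toNNReal) with hM₁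
  set M₂ : ℝ≥0 := M * (1 / (2 - p)).toNNReal with hM₂
  refine ⟨fun j => M₁ ^ (1 / p) * b j ^ ((p - s) / p) + M₂ ^ (1 / p) * b j, ?_, ?_⟩
  · refine Summable.add (Summable.mul_left _ ?_) (Summable.mul_left _ ?_)
    · simp only [hb, NNReal.mul_rpow]
      exact (ha_sum _ (div_pos hps hp0)).mul_left _
    · have := ha_sum 1 one_pos
      simp only [NNReal.rpow_one] at this
      exact this.mul_left _
  · intro X _ μ _ Z T S H j f hf
    rw [eLpNorm_le_mul_eLpNorm_iff hp0]
    simp only [enorm_eq_self]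
    refine (H.lintegral_shift_le_of_lt_two hp₀.1 hs hsp hp2 j (ha j) hf).trans ?_
    gcongr
    have e1 : ∀ (e c : ℝ), 0 ≤ e → ENNReal.ofReal (((C₄ + 1) * a j : ℝ) ^ e / c) =
        ((b j ^ e : ℝ≥0) : ℝ≥0∞) * ((1 / c).toNNReal : ℝ≥0) := fun e c he => by
      have : ((C₄ + 1) * a j : ℝ) = (b j : ℝ) := by simp [hb]
      rw [this, ← NNReal.coe_rpow, div_eq_mul_one_div, ENNReal.ofReal_mul (NNReal.coe_nonneg _),
        ENNReal.ofReal_coe_nnreal]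
      rfl
    rw [e1 _ _ hps.le, e1 _ _ hp0.le,
      ← ENNReal.coe_rpow_of_nonneg _ (by linarith [hp₀.1] : (0 : ℝ) ≤ s)]
    change (M : ℝ≥0∞) * (A * _ + _) ≤ _
    rw [← ENNReal.coe_rpow_of_nonneg _ hp0.le]
    norm_cast
    calc M * (A * (b j ^ (p - s) * (1 / (p - s)).toNNReal) + b j ^ p * (1 / (2 - p)).toNNReal)
        = M₁ * b j ^ (p - s) + M₂ * b j ^ p := by rw [hM₁, hM₂]; ring
      _ = (M₁ ^ (1 / p) * b j ^ ((p - s) / p)) ^ p + (M₂ ^ (1 / p) * b j) ^ p := by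
        have h1 : ∀ x : ℝ≥0, (x ^ (1 / p)) ^ p = x := fun x => by
          rw [← NNReal.rpow_mul, one_div_mul_cancel hp0.ne', NNReal.rpow_one]
        have h3 : (b j ^ ((p - s) / p)) ^ p = b j ^ (p - s) := by
          rw [← NNReal.rpow_mul, div_mul_cancel₀ _ hp0.ne']
        have h4 : ∀ x y : ℝ≥0, (x * y) ^ p = x ^ p * y ^ p := fun _ _ => NNReal.mul_rpow
        rw [h4 (M₁ ^ (1 / p)), h4 (M₂ ^ (1 / p)), h1, h1, h3]
      _ ≤ _ := NNReal.add_rpow_le_rpow_add _ _ hp1.le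

/-- Minkowski's inequality for series. -/
theorem eLpNorm_tsum_le {X ι : Type*} [Countable ι] [MeasurableSpace X] {μ : Measure X} {p : ℝ}
    (hp : 1 ≤ p) {u : ι → X → ℝ≥0∞} (hu : ∀ i, AEMeasurable (u i) μ) :
    eLpNorm (fun x => ∑' i, u i x) (ENNReal.ofReal p) μ ≤
      ∑' i, eLpNorm (u i) (ENNReal.ofReal p) μ := by
  classical
  have hp0 : 0 < p := by linarith
  have h0 : ENNReal.ofReal p ≠ 0 := by simpa using hp0
  have hE : ∀ v : X → ℝ≥0∞, eLpNorm v (ENNReal.ofReal p) μ = (∫⁻ x, v x ^ p ∂μ) ^ (1 / p) :=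
    fun v => by
      rw [eLpNorm_eq_lintegral_rpow_enorm_toReal h0 ENNReal.ofReal_ne_top,
        ENNReal.toReal_ofReal hp0.le]
      rfl
  have hsup : ∀ x, (∑' i, u i x) ^ p = ⨆ s : Finset ι, (∑ i ∈ s, u i x) ^ p := fun x => by
    rw [ENNReal.tsum_eq_iSup_sum]
    exact (ENNReal.orderIsoRpow p hp0).map_iSup _
  rw [hE]
  simp only [hsup]
  rw [lintegral_iSup_directed fun s => (Finset.aemeasurable_fun_sum s fun i _ => hu i).pow_const p]
  · rw [one_div, ENNReal.rpow_inv_le_iff hp0]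
    refine iSup_le fun s => ?_
    rw [← ENNReal.rpow_inv_le_iff hp0, ← one_div, ← hE]
    refine le_trans ?_ (ENNReal.sum_le_tsum s)
    have h := eLpNorm_sum_le (s := s) (f := u) (μ := μ) (p := ENNReal.ofReal p)
      (fun i _ => (hu i).aestronglyMeasurable) (by simpa using hp)
    refine le_of_eq_of_le ?_ h
    congr 1
    ext x
    simp
  · exact directed_of_isDirected_le fun s s' hss' x => by
      gcongr

namespace ShortVariationHypotheses

variable {X : Type*} [MeasurableSpace X] {μ : Measure X} {p₀ : ℝ} {C₁ C₂ C₃ : ℝ → ℝ≥0} {C₄ : ℝ≥0}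
  {a : ℤ → ℝ≥0} {Z : Set ℝ} {T : ℝ → (X → ℂ) → (X → ℂ)} {S : ℤ → (X → ℂ) → (X → ℂ)}

/-- The theorem for a finite parameter set, from bounds of the frequency-localised pieces. -/
theorem eLpNorm_ellTwo_rVariation_le (H : ShortVariationHypotheses μ p₀ C₁ C₂ C₃ C₄ a Z T S)
    (hp₀ : p₀ ∈ Set.Ico (1 : ℝ) 2) {p : ℝ} (hp : p ∈ Set.Ioc p₀ 2) {D : ℤ → ℝ≥0}
    (hD : Summable D)
    (hbound : ∀ (j : ℤ) (f : X → ℂ), MemLp f (ENNReal.ofReal p) μ →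
      eLpNorm (fun x => ellTwo fun n =>
        rVariation 2 (fun t => T t (S (j + n) f) x) (dyadicBlock Z n)) (ENNReal.ofReal p) μ ≤
        D j * eLpNorm f (ENNReal.ofReal p) μ)
    {f : X → ℂ} (hf : MemLp f (ENNReal.ofReal p) μ) :
    eLpNorm (fun x => ellTwo fun n => rVariation 2 (fun t => T t f x) (dyadicBlock Z n))
      (ENNReal.ofReal p) μ ≤ (∑' j, D j : ℝ≥0) * eLpNorm f (ENNReal.ofReal p) μ := by
  have hp1 : 1 < p := hp₀.1.trans_lt hp.1
  have hp0 : 0 < p := by linarith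
  have hp1' : 1 ≤ ENNReal.ofReal p := by simpa using hp1.le
  have h0 : ENNReal.ofReal p ≠ 0 := by simpa using hp0
  -- functions that also belong to `L^2`
  have hL2 : ∀ g : X → ℂ, MemLp g (ENNReal.ofReal p) μ → MemLp g 2 μ →
      eLpNorm (fun x => ellTwo fun n => rVariation 2 (fun t => T t g x) (dyadicBlock Z n))
        (ENNReal.ofReal p) μ ≤ (∑' j, D j : ℝ≥0) * eLpNorm g (ENNReal.ofReal p) μ := by
    intro g hg hg2
    calc _ ≤ eLpNorm (fun x => ∑' j : ℤ, ellTwo fun n =>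
          rVariation 2 (fun t => T t (S (j + n) g) x) (dyadicBlock Z n)) (ENNReal.ofReal p) μ := by
          refine eLpNorm_mono_enorm_ae ?_
          filter_upwards [H.ellTwo_rVariation_le_tsum hp₀ hg2] with x hx
          rwa [enorm_eq_self, enorm_eq_self]
      _ ≤ ∑' j : ℤ, eLpNorm (fun x => ellTwo fun n =>
          rVariation 2 (fun t => T t (S (j + n) g) x) (dyadicBlock Z n)) (ENNReal.ofReal p) μ :=
          eLpNorm_tsum_le hp1.le fun j => H.aemeasurable_ellTwo_rVariation hp1.le fun n =>
            H.memLp_S ⟨hp1, hp.2⟩ hg _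
      _ ≤ ∑' j : ℤ, (D j : ℝ≥0∞) * eLpNorm g (ENNReal.ofReal p) μ :=
          ENNReal.tsum_le_tsum fun j => hbound j g hg
      _ = _ := by rw [ENNReal.tsum_mul_right, ENNReal.coe_tsum hD]
  obtain ⟨K, -, hK⟩ := exists_ellTwo_rVariation_le_iSup H.finite H.pos
  set C : ℝ≥0 := ∑' j, D j
  -- approximation of `f` by simple functions
  have happrox : ∀ ε : ℝ≥0, 0 < ε →
      eLpNorm (fun x => ellTwo fun n => rVariation 2 (fun t => T t f x) (dyadicBlock Z n))
        (ENNReal.ofReal p) μ ≤ C * eLpNorm f (ENNReal.ofReal p) μ + (C + K * C₂ p) * ε := by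
    intro ε hε
    obtain ⟨g', hgε, hg⟩ := hf.exists_simpleFunc_eLpNorm_sub_lt ENNReal.ofReal_ne_top
      (ε := (ε : ℝ≥0∞)) (by exact_mod_cast hε.ne')
    have hg2 : MemLp g' 2 μ := (SimpleFunc.memLp_iff_finMeasSupp two_ne_zero
      ENNReal.ofNat_ne_top).2 ((SimpleFunc.memLp_iff_finMeasSupp h0 ENNReal.ofReal_ne_top).1 hg)
    set g : X → ℂ := ⇑g'
    have hfg : MemLp (f - g) (ENNReal.ofReal p) μ := hf.sub hg
    have hgnorm : eLpNorm g (ENNReal.ofReal p) μ ≤ eLpNorm f (ENNReal.ofReal p) μ + ε := by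
      have h1 : g = f - (f - g) := by abel
      rw [h1]
      exact (eLpNorm_sub_le hf.1 hfg.1 hp1').trans (by gcongr)
    have hrest : eLpNorm (fun x => ellTwo fun n =>
        rVariation 2 (fun t => T t (f - g) x) (dyadicBlock Z n)) (ENNReal.ofReal p) μ ≤
        K * (C₂ p * ε) := by
      have h1 : eLpNorm (fun x => ellTwo fun n =>
          rVariation 2 (fun t => T t (f - g) x) (dyadicBlock Z n)) (ENNReal.ofReal p) μ ≤
          K * eLpNorm (fun x => ⨆ t ∈ Z, ‖T t (f - g) x‖ₑ) (ENNReal.ofReal p) μ := by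
        rw [eLpNorm_le_mul_eLpNorm_iff hp0, ← lintegral_const_mul' _ _
          (ENNReal.rpow_lt_top_of_nonneg hp0.le ENNReal.coe_ne_top).ne]
        refine lintegral_mono fun x => ?_
        rw [← ENNReal.mul_rpow_of_nonneg _ _ hp0.le]
        gcongr
        exact hK _
      refine h1.trans ?_
      gcongr
      refine (H.maximal p hp _ hfg).trans ?_
      gcongr
    calc _ ≤ eLpNorm ((fun x => ellTwo fun n =>
            rVariation 2 (fun t => T t g x) (dyadicBlock Z n)) + fun x => ellTwo fun n =>
            rVariation 2 (fun t => T t (f - g) x) (dyadicBlock Z n)) (ENNReal.ofReal p) μ := by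
          refine eLpNorm_mono_enorm_ae ?_
          filter_upwards [H.ellTwo_rVariation_add_le hp1.le (f := fun _ => f) (g := fun _ => g)
            (h := fun _ => f - g) (fun _ => hg) (fun _ => hfg)
            fun _ => by rw [add_sub_cancel]] with x hx
          simpa using hx
      _ ≤ _ := eLpNorm_add_le
          (H.aemeasurable_ellTwo_rVariation hp1.le fun _ => hg).aestronglyMeasurable
          (H.aemeasurable_ellTwo_rVariation hp1.le fun _ => hfg).aestronglyMeasurable hp1'
      _ ≤ C * (eLpNorm f (ENNReal.ofReal p) μ + ε) + K * (C₂ p * ε) :=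
          add_le_add ((hL2 g hg hg2).trans (by gcongr)) hrest
      _ = _ := by ring
  refine ENNReal.le_of_forall_pos_le_add fun ε hε _ => ?_
  refine (happrox (ε / (C + K * C₂ p + 1)) (by positivity)).trans ?_
  gcongr
  norm_cast
  rw [← mul_div_assoc]
  refine div_le_of_le_mul₀ zero_le zero_le ?_
  calc (C + K * C₂ p) * ε ≤ (C + K * C₂ p + 1) * ε := mul_le_mul_left le_self_add _
    _ = _ := mul_comm _ _

end ShortVariationHypotheses

/-! ### Reduction to finite parameter sets -/

/-- A countable subset that is dense in every dyadic block. -/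
theorem exists_countable_subset_dense_dyadicBlock (Z : Set ℝ) :
    ∃ Z' ⊆ Z, Z'.Countable ∧ ∀ n, dyadicBlock Z n ⊆ closure (dyadicBlock Z' n) := by
  have h : ∀ n : ℤ, ∃ c ⊆ dyadicBlock Z n, c.Countable ∧ dyadicBlock Z n ⊆ closure c := fun n =>
    (TopologicalSpace.IsSeparable.of_separableSpace
      (dyadicBlock Z n)).exists_countable_dense_subset
  choose c hsub hc hdense using h
  refine ⟨⋃ n, c n, iUnion_subset fun n => (hsub n).trans (dyadicBlock_subset Z n),
    countable_iUnion hc, fun n => (hdense n).trans (closure_mono fun t ht => ?_)⟩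
  exact ⟨(hsub n ht).1, mem_iUnion.2 ⟨n, ht⟩⟩

/-- A countable set is an increasing union of finite sets. -/
theorem exists_monotone_finite_iUnion_eq {Z : Set ℝ} (hZ : Z.Countable) :
    ∃ F : ℕ → Set ℝ, Monotone F ∧ (∀ m, (F m).Finite) ∧ ⋃ m, F m = Z := by
  obtain ⟨e, he⟩ := Set.countable_iff_exists_injOn.1 hZ
  refine ⟨fun m => {t ∈ Z | e t ≤ m}, fun m m' h t ht => ⟨ht.1, ht.2.trans h⟩, fun m => ?_, ?_⟩
  · refine Set.Finite.of_finite_image (f := e) ((finite_Iic m).subset ?_)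
      (he.mono fun t ht => ht.1)
    rintro _ ⟨t, ht, rfl⟩
    exact ht.2
  · ext t
    simp only [mem_iUnion, mem_ofPred_eq]
    exact ⟨fun ⟨_, h⟩ => h.1, fun h => ⟨e t, h, le_rfl⟩⟩

/-- Monotone convergence: a bound for all finite subsets of a countable parameter set passes to
the whole set. -/
theorem eLpNorm_ellTwo_rVariation_le_of_finite {X : Type*} [MeasurableSpace X] {μ : Measure X}
    {p : ℝ} (hp : 0 < p) {Z : Set ℝ} (hZ : Z.Countable) {c : ℝ → X → ℂ}
    (hc : ∀ t ∈ Z, AEMeasurable (c t) μ) {B : ℝ≥0∞}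
    (h : ∀ F ⊆ Z, F.Finite → eLpNorm (fun x => ellTwo fun n =>
      rVariation 2 (fun t => c t x) (dyadicBlock F n)) (ENNReal.ofReal p) μ ≤ B) :
    eLpNorm (fun x => ellTwo fun n => rVariation 2 (fun t => c t x) (dyadicBlock Z n))
      (ENNReal.ofReal p) μ ≤ B := by
  obtain ⟨F, hmono, hfin, hU⟩ := exists_monotone_finite_iUnion_eq hZ
  have hFZ : ∀ m, F m ⊆ Z := fun m => hU ▸ subset_iUnion F m
  set W : ℕ → X → ℝ≥0∞ := fun m x => ellTwo fun n =>
    rVariation 2 (fun t => c t x) (dyadicBlock (F m) n)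
  have hWm : ∀ m, AEMeasurable (W m) μ := fun m => AEMeasurable.ellTwo fun n =>
    aemeasurable_rVariation two_pos ((hfin m).subset (dyadicBlock_subset _ n)) fun t ht =>
      hc t (hFZ m (dyadicBlock_subset _ n ht))
  have hWmono : ∀ x, Monotone fun m => W m x := fun x m m' hmm => ellTwo_mono fun n =>
    rVariation_mono _ _ (dyadicBlock_mono (hmono hmm) n)
  have hle : ∀ x, ellTwo (fun n => rVariation 2 (fun t => c t x) (dyadicBlock Z n)) ≤
      ⨆ m, W m x := fun x => by
    rw [← ellTwo_iSup fun m m' hmm n => rVariation_mono _ _ (dyadicBlock_mono (hmono hmm) n)]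
    refine ellTwo_mono fun n => ?_
    have : dyadicBlock Z n = ⋃ m, dyadicBlock (F m) n := by
      simp only [dyadicBlock]
      rw [← inter_iUnion, hU]
    rw [this]
    exact rVariation_iUnion_le _ _ fun m m' hmm => dyadicBlock_mono (hmono hmm) n
  have h0 : ENNReal.ofReal p ≠ 0 := by simpa using hp
  have hE : ∀ v : X → ℝ≥0∞, eLpNorm v (ENNReal.ofReal p) μ = (∫⁻ x, v x ^ p ∂μ) ^ p⁻¹ :=
    fun v => by
      rw [eLpNorm_eq_lintegral_rpow_enorm_toReal h0 ENNReal.ofReal_ne_top,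
        ENNReal.toReal_ofReal hp.le, one_div]
      rfl
  refine (eLpNorm_mono_enorm (g := fun x => ⨆ m, W m x) fun x => ?_).trans ?_
  · rw [enorm_eq_self, enorm_eq_self]
    exact hle x
  · have hsup : ∀ x, (⨆ m, W m x) ^ p = ⨆ m, W m x ^ p := fun x =>
      (ENNReal.orderIsoRpow p hp).map_iSup _
    rw [hE, ENNReal.rpow_inv_le_iff hp]
    simp only [hsup]
    rw [lintegral_iSup' (fun m => (hWm m).pow_const p)
      (ae_of_all _ fun x m m' hmm => ENNReal.rpow_le_rpow (hWmono x hmm) hp.le)]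
    refine iSup_le fun m => ?_
    rw [← ENNReal.rpow_inv_le_iff hp, ← hE]
    exact h _ (hFZ m) (hfin m)

theorem mainTheorem8 (p₀ : ℝ) (hp₀ : p₀ ∈ Set.Ico (1 : ℝ) 2)
    (C₁ C₂ C₃ : ℝ → ℝ≥0) (C₄ : ℝ≥0)
    (a : ℤ → ℝ≥0) (ha : ∀ j, 0 < a j) (ha_sum : ∀ ρ : ℝ, 0 < ρ → Summable fun j => a j ^ ρ)
    (p : ℝ) (hp : p ∈ Set.Ioc p₀ 2) :
    ∃ C : ℝ≥0, 0 < C ∧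
      ∀ (X : Type*) [MeasurableSpace X] (μ : Measure X) [SigmaFinite μ]
        (Z : Set ℝ) (_ : Z ⊆ Set.Ioi 0)
        (T : ℝ → (X → ℂ) → (X → ℂ)) (S : ℤ → (X → ℂ) → (X → ℂ)),
        -- the `T t`, `t ∈ Z`, are positive linear operators on `⋃_{1 ≤ q ≤ ∞} L^q`
        (∀ t ∈ Z, IsPositiveLinearOperator μ (T t)) →
        -- continuity in the parameter, to make suprema over an uncountable `Z` meaningful
        (¬ Z.Countable → ∀ q ∈ Set.Ioc p₀ 2, ∀ f : X → ℂ, MemLp f (ENNReal.ofReal q) μ →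
          ∀ᵐ x ∂μ, ContinuousOn (fun t => T t f x) Z) →
        -- the `S n` are linear operators on `⋃_{1 < q ≤ 2} L^q`
        (∀ n, IsLinearOnLp μ (Set.Ioc 1 2) (S n)) →
        -- `f = ∑ S n f` in `L²`
        (∀ f : X → ℂ, MemLp f 2 μ →
          Tendsto (fun N : ℕ =>
            eLpNorm (fun x => f x - ∑ n ∈ Finset.Icc (-(N : ℤ)) N, S n f x) 2 μ)
            atTop (𝓝 0)) →
        -- square function bound
        (∀ q ∈ Set.Ioc (1 : ℝ) 2, ∀ f : X → ℂ, MemLp f (ENNReal.ofReal q) μ →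
          eLpNorm (fun x => ellTwo fun n => ‖S n f x‖ₑ) (ENNReal.ofReal q) μ
            ≤ C₁ q * eLpNorm f (ENNReal.ofReal q) μ) →
        -- maximal bound
        (∀ q ∈ Set.Ioc p₀ 2, ∀ f : X → ℂ, MemLp f (ENNReal.ofReal q) μ →
          eLpNorm (fun x => ⨆ t ∈ Z, ‖T t f x‖ₑ) (ENNReal.ofReal q) μ
            ≤ C₂ q * eLpNorm f (ENNReal.ofReal q) μ) →
        -- uniform variational bound on the dyadic blocks
        (∀ q ∈ Set.Ioc p₀ 2, ∀ f : X → ℂ, MemLp f (ENNReal.ofReal q) μ →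
          (⨆ n : ℤ, eLpNorm (fun x => rVariation q (fun t => T t f x) (dyadicBlock Z n))
              (ENNReal.ofReal q) μ)
            ≤ C₃ q * eLpNorm f (ENNReal.ofReal q) μ) →
        -- `L²` decay
        (∀ j : ℤ, ∀ f : X → ℂ, MemLp f 2 μ →
          eLpNorm (fun x => ellTwo fun n =>
              rVariation 2 (fun t => T t (S (j + n) f) x) (dyadicBlock Z n)) 2 μ
            ≤ C₄ * a j * eLpNorm f 2 μ) →
        -- conclusion: bound for the short variations
        ∀ f : X → ℂ, MemLp f (ENNReal.ofReal p) μ →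
          eLpNorm (fun x => ellTwo fun n =>
              rVariation 2 (fun t => T t f x) (dyadicBlock Z n)) (ENNReal.ofReal p) μ
            ≤ C * eLpNorm f (ENNReal.ofReal p) μ := by
  obtain ⟨D, hD, hbound⟩ := exists_summable_shift_bound p₀ hp₀ C₁ C₂ C₃ C₄ a ha ha_sum p hp
  refine ⟨∑' j, D j + 1, by positivity, ?_⟩
  intro X _ μ _ Z hZ T S hT hcont hS htendsto hsquare hmax hvar hdecay f hf
  have hp1 : 1 < p := hp₀.1.trans_lt hp.1
  -- the bound for finite subsets of `Z`
  have hfinite : ∀ F ⊆ Z, F.Finite → eLpNorm (fun x => ellTwo fun n =>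
      rVariation 2 (fun t => T t f x) (dyadicBlock F n)) (ENNReal.ofReal p) μ ≤
      (∑' j, D j + 1 : ℝ≥0) * eLpNorm f (ENNReal.ofReal p) μ := by
    intro F hFZ hF
    have H : ShortVariationHypotheses μ p₀ C₁ C₂ C₃ C₄ a F T S :=
      { finite := hF
        pos := hFZ.trans hZ
        positive := fun t ht => hT t (hFZ ht)
        linear := hS
        tendsto := htendsto
        square := hsquare
        maximal := fun q hq g hg => le_trans (eLpNorm_mono_enorm fun x =>
          biSup_mono fun t ht => hFZ ht) (hmax q hq g hg)
        variation := fun q hq g hg n => le_trans (eLpNorm_mono_enorm fun x =>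
          rVariation_mono _ _ (dyadicBlock_mono hFZ n))
          ((le_iSup (fun n : ℤ => eLpNorm (fun x =>
            rVariation q (fun t => T t g x) (dyadicBlock Z n)) (ENNReal.ofReal q) μ) n).trans
            (hvar q hq g hg))
        decay := fun j g hg => le_trans (eLpNorm_mono_enorm fun x =>
          ellTwo_mono fun n => rVariation_mono _ _ (dyadicBlock_mono hFZ n)) (hdecay j g hg) }
    refine (H.eLpNorm_ellTwo_rVariation_le hp₀ hp hD (hbound X μ F T S H) hf).trans ?_
    gcongr
    exact le_self_add
  have hmeas : ∀ t ∈ Z, AEMeasurable (T t f) μ := fun t ht =>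
    ((hT t ht).linear.aestronglyMeasurable _ ⟨by simpa using hp1.le, le_top⟩ f hf).aemeasurable
  by_cases hc : Z.Countable
  · exact eLpNorm_ellTwo_rVariation_le_of_finite (by linarith) hc hmeas hfinite
  · obtain ⟨Z', hsub, hc', hdense⟩ := exists_countable_subset_dense_dyadicBlock Z
    refine le_trans (eLpNorm_mono_enorm_ae ?_) (eLpNorm_ellTwo_rVariation_le_of_finite
      (by linarith) hc' (fun t ht => hmeas t (hsub ht)) fun F hF => hfinite F (hF.trans hsub))
    filter_upwards [hcont hc p hp f hf] with x hx
    rw [enorm_eq_self, enorm_eq_self]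
    exact ellTwo_mono fun n => rVariation_le_of_dense (dyadicBlock_mono hsub n) (hdense n)
      (hx.mono (dyadicBlock_subset Z n))
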